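/- **Model.** A network is a finite connected simple graph $G=(V,E)$ with $n=|V|$ vertices, equipped with pairwise distinct identifiers in $\mathbb{N}$ of $O(\log n)$ bits, i.e. of at most $c\cdot\ell(n)$ bits, where $c$ is a fixed constant and $\ell(n)$ is the length of the binary expansion of $n$. A certificate assignment gives each vertex a finite bit string. The view at distance $k$ of a vertex $v$ consists of the vertices at distance at most $k$ from $v$, with their identifiers and certificates, and of the edges between these vertices except those joining two vertices at distance exactly $k$ from $v$. A graph property $P$ has a local certification of size $s:\mathbb{N}\to\mathbb{N}$ with verification radius $k$ if there is a verification algorithm, that is, a function mapping every view at distance $k$ to accept or reject, such that for every network $G$ on $n$ vertices and every admissible choice of identifiers: * if $G$ satisfies $P$, then for some assignment of certificates of at most $s(n)$ bits every vertex accepts; * if $G$ does not satisfy $P$, then for every assignment of certificates at least one vertex rejects. **Theorem.** Let $k\ge 2$, and let $c$ be the constant in the bound on the identifiers. There is a function $s$ with $s(n)=O(n^{3/2}\log^2 n)$ (where the implied constant may depend on $k$ and $c$) such that for every finite graph $H$ on at most $4k-1$ vertices both of the following properties have a local certification of size $s$ with verification radius $k$: 1. $G$ does not contain $H$ as an induced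 subgraph; 2. $G$ does not contain $H$ as a (not necessarily induced) subgraph. -/

import Mathlib

universe u v

/-- What a node sees of the network. As identifiers are unique, nodes are named by their identifiers:
`center` is the observing node, `nodes` lists the visible nodes together with their certificates,
and `edges` lists the visible edges (in both orientations). -/
structure LocalView where
  center : ℕ
  nodes : Set (ℕ × List Bool)
  edges : Set (ℕ × ℕ)

/-- The view at distance `k` of the node `x`: the nodes at distance at most `k` from `x`, their
identifiers and certificates, and the edges between these nodes except those joining two nodes
at distance exactly `k`. -/
def localView {V : Type u} (G : SimpleGraph V) (ident : V → ℕ) (cert : V → List Bool)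
    (k : ℕ) (x : V) : LocalView where
  center := ident x
  nodes := {p | ∃ y : V, G.edist x y ≤ k ∧ p = (ident y, cert y)}
  edges := {p | ∃ y z : V, G.Adj y z ∧ G.edist x y ≤ k ∧ G.edist x z ≤ k ∧
    ¬ (G.edist x y = k ∧ G.edist x z = k) ∧ p = (ident y, ident z)}

/-- Unique identifiers on `O(log n)` bits, where `n` is the number of vertices: the identifiers are
pairwise distinct, and each one is written on at most `c` times as many bits as `n`
(`Nat.size m` is the length of the binary expansion of `m`). -/
def IsIdentAssignment (c : ℕ) {V : Type u} [Fintype V] (ident : V → ℕ) : Prop :=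
  Function.Injective ident ∧ ∀ x, (ident x).size ≤ c * (Fintype.card V).size

/-- The property `P` of networks (finite connected graphs) has a local certification with
verification radius `k` and certificates of at most `s n` bits on `n`-vertex networks, when the
identifiers have at most `c * Nat.size n` bits. The verification algorithm is an arbitrary function
of the view (`true` means accept); in particular it is not told `n`, and the certificates it may
face on an instance that violates `P` are arbitrary. -/
def HasLocalCertification (c k : ℕ) (s : ℕ → ℕ)
    (P : ∀ (V : Type u) [Fintype V], SimpleGraph V → Prop) : Prop :=
  ∃ verify : LocalView → Bool,
    ∀ (V : Type u) [Fintype V] (G : SimpleGraph V), G.Connected →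
    ∀ ident : V → ℕ, IsIdentAssignment c ident →
      (P V G → ∃ cert : V → List Bool, (∀ x, (cert x).length ≤ s (Fintype.card V)) ∧
        ∀ x, verify (localView G ident cert k x) = true) ∧
      (¬ P V G → ∀ cert : V → List Bool,
        ∃ x, verify (localView G ident cert k x) = false)

/-!
Let every node hold the edges at one of about `√n` groups of about `√n` vertices, the group being
drawn at random. A node of degree at least of order `√n log n` then has a neighbour in charge of
every group, so that it gathers all the edges of the network. Call these nodes high. The remaining
nodes are incident to `O(n^{3/2} log n)` edges in total, and these edges are listed in a map that is
given to every node.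

The nodes at distance less than `k` from the high nodes form zones, levelled by that distance. A
high node can check the gathered edges within its own zone, because consecutive high nodes of a zone
are both seen by some node that compares what they have gathered. What no node can check directly is
the adjacency of high nodes in two different zones at once, when both pairs are missing from the
map. As the pattern has fewer than `4 k` vertices, at most one zone contains `2 k` of them. In any
other zone some level below `k` carries at most one vertex of the copy, and the part of the copy
below that level interacts with the rest through this vertex alone. It can thus be exchanged for a
representative depending only on that vertex, on the level, and on the vertices of the pattern
involved. These are linearly many choices, so all the adjacencies within representatives fit into
the map. After the exchange, a high node of the exceptional zone, or any node if there is none,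
knows the whole copy.
-/

/-! ### Self-delimiting binary codes -/

/-- A binary code whose codewords can be read off from the left of any bit string. -/
def SelfDelimiting {α : Type*} (code : α → List Bool) : Prop :=
  ∀ a b s t, code a ++ s = code b ++ t → a = b ∧ s = t

/-- The code of a list: every element is announced by the bit `true`, the end by `false`. -/
def listCode {α : Type*} (code : α → List Bool) : List α → List Bool
  | [] => [false]
  | a :: l => true :: (code a ++ listCode code l)

/-- The concatenation of the codes of the two components. -/
def prodCode {α β : Type*} (code : α → List Bool) (code' : β → List Bool) (p : α × β) :
    List Bool :=
  code p.1 ++ code' p.2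

/-- The code of a natural number, read off from its binary expansion. -/
def natCode (m : ℕ) : List Bool := listCode (fun b => [b]) m.bits

namespace SelfDelimiting

variable {α β : Type*} {code : α → List Bool} {code' : β → List Bool}

theorem injective (h : SelfDelimiting code) : Function.Injective code :=
  fun a b hab => (h a b [] [] (by rw [hab])).1

theorem comp (h : SelfDelimiting code') {f : α → β} (hf : Function.Injective f) :
    SelfDelimiting (code' ∘ f) :=
  fun _ _ _ _ hab => ⟨hf (h _ _ _ _ hab).1, (h _ _ _ _ hab).2⟩

theorem prodCode (h : SelfDelimiting code) (h' : SelfDelimiting code') :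
    SelfDelimiting (prodCode code code') := by
  rintro ⟨a, b⟩ ⟨a', b'⟩ s t hab
  simp only [_root_.prodCode, List.append_assoc] at hab
  obtain ⟨rfl, hb⟩ := h _ _ _ _ hab
  obtain ⟨rfl, hs⟩ := h' _ _ _ _ hb
  exact ⟨rfl, hs⟩

theorem listCode (h : SelfDelimiting code) : SelfDelimiting (listCode code)
  | [], [], s, t, hst => by simpa [_root_.listCode] using hst
  | [], b :: m, s, t, hst => by simp [_root_.listCode] at hst
  | a :: l, [], s, t, hst => by simp [_root_.listCode] at hst
  | a :: l, b :: m, s, t, hst => by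
    simp only [_root_.listCode, List.cons_append, List.cons.injEq, true_and,
      List.append_assoc] at hst
    obtain ⟨rfl, htail⟩ := h _ _ _ _ hst
    obtain ⟨rfl, hs⟩ := h.listCode _ _ _ _ htail
    exact ⟨rfl, hs⟩

end SelfDelimiting

theorem selfDelimiting_natCode : SelfDelimiting natCode := by
  have hbit : SelfDelimiting fun b : Bool => [b] := fun a b s t h => by simpa using h
  refine hbit.listCode.comp (f := Nat.bits) fun a b h => ?_
  rw [← Nat.digits_inj_iff (b := 2), Nat.digits_two_eq_bits, Nat.digits_two_eq_bits, h]

theorem length_listCode_le {α : Type*} {code : α → List Bool} {l : List α} {B : ℕ}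
    (h : ∀ a ∈ l, (code a).length ≤ B) : (listCode code l).length ≤ l.length * (B + 1) + 1 := by
  induction l with
  | nil => simp [listCode]
  | cons a l ih =>
    have ha := h a List.mem_cons_self
    have hl := ih fun b hb => h b (List.mem_cons_of_mem a hb)
    simp only [listCode, List.length_cons, List.length_append]
    linarith

theorem length_prodCode {α β : Type*} (code : α → List Bool) (code' : β → List Bool) (p : α × β) :
    (prodCode code code' p).length = (code p.1).length + (code' p.2).length :=
  List.length_append

theorem length_natCode_le (m : ℕ) : (natCode m).length ≤ 2 * m.size + 1 := by
  have h : (natCode m).length ≤ m.bits.length * (1 + 1) + 1 :=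
    length_listCode_le fun _ _ => le_rfl
  rw [← Nat.size_eq_bits_len]
  linarith

/-! ### Certificates -/

/-- What all the nodes agree on: a table `(identifier, label, level)` of the nodes, a list of
edges, and a list of pairs of nodes whose adjacency is declared known. -/
structure GlobalMap where
  vertices : List (ℕ × ℕ × ℕ)
  edges : List (ℕ × ℕ)
  known : List (ℕ × ℕ)

/-- A certificate consists of the global map and of a share of the edges of the network. -/
structure Certificate where
  map : GlobalMap
  share : List (ℕ × ℕ)

namespace Certificate

instance : Inhabited Certificate := ⟨⟨⟨[], [], []⟩, []⟩⟩

/-- The binary code of a certificate. -/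
def code : Certificate → List Bool :=
  prodCode (listCode (prodCode natCode (prodCode natCode natCode)))
    (prodCode (listCode (prodCode natCode natCode))
      (prodCode (listCode (prodCode natCode natCode)) (listCode (prodCode natCode natCode)))) ∘
    fun d => (d.map.vertices, d.map.edges, d.map.known, d.share)

theorem code_injective : Function.Injective code := by
  have hnat := selfDelimiting_natCode
  have hpairs := (hnat.prodCode hnat).listCode
  refine ((hnat.prodCode (hnat.prodCode hnat)).listCode.prodCode
    (hpairs.prodCode (hpairs.prodCode hpairs))).injective.comp ?_
  rintro ⟨⟨_, _, _⟩, _⟩ ⟨⟨_, _, _⟩, _⟩ h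
  simp_all only [Prod.mk.injEq]

/-- The certificate written on a bit string, and an arbitrary certificate if there is none. -/
noncomputable def decode : List Bool → Certificate := Function.invFun code

theorem decode_code (d : Certificate) : decode (code d) = d :=
  Function.leftInverse_invFun code_injective d

theorem length_pairsCode_le {l : List (ℕ × ℕ)} {B : ℕ}
    (hl : ∀ t ∈ l, t.1.size ≤ B ∧ t.2.size ≤ B) :
    (listCode (prodCode natCode natCode) l).length ≤ l.length * (6 * B + 4) + 1 := by
  refine length_listCode_le fun t ht => ?_
  have hB := hl t ht
  have h₁ := length_natCode_le t.1
  have h₂ := length_natCode_le t.2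
  rw [length_prodCode]
  omega

theorem length_triplesCode_le {l : List (ℕ × ℕ × ℕ)} {B : ℕ}
    (hl : ∀ t ∈ l, t.1.size ≤ B ∧ t.2.1.size ≤ B ∧ t.2.2.size ≤ B) :
    (listCode (prodCode natCode (prodCode natCode natCode)) l).length ≤
      l.length * (6 * B + 4) + 1 := by
  refine length_listCode_le fun t ht => ?_
  have hB := hl t ht
  have h₁ := length_natCode_le t.1
  have h₂ := length_natCode_le t.2.1
  have h₃ := length_natCode_le t.2.2
  rw [length_prodCode, length_prodCode]
  omega

theorem length_code_le (d : Certificate) (B : ℕ)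
    (hv : ∀ t ∈ d.map.vertices, t.1.size ≤ B ∧ t.2.1.size ≤ B ∧ t.2.2.size ≤ B)
    (he : ∀ t ∈ d.map.edges, t.1.size ≤ B ∧ t.2.size ≤ B)
    (hk : ∀ t ∈ d.map.known, t.1.size ≤ B ∧ t.2.size ≤ B)
    (hs : ∀ t ∈ d.share, t.1.size ≤ B ∧ t.2.size ≤ B) :
    d.code.length ≤ (d.map.vertices.length + d.map.edges.length + d.map.known.length +
      d.share.length) * (6 * B + 4) + 4 := by
  have hvl := length_triplesCode_le hv
  have hel := length_pairsCode_le he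
  have hkl := length_pairsCode_le hk
  have hsl := length_pairsCode_le hs
  simp only [code, Function.comp_apply, length_prodCode]
  linarith

end Certificate

/-! ### Colourings in which large neighbourhoods see all the colours -/

theorem two_mul_pow_le_succ_pow (p : ℕ) : 2 * p ^ (p + 1) ≤ (p + 1) ^ (p + 1) := by
  rcases p.eq_zero_or_pos with rfl | hp
  · simp
  have hbernoulli : p ^ p + p * p ^ (p - 1) ≤ (p + 1) ^ p := by
    simpa using pow_add_mul_le_add_pow_of_sq_nonneg (R := ℕ) (a := p) (b := 1) (by simp) (by simp)
      (by simp) (by simp) p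
  rw [← pow_succ', Nat.sub_add_cancel hp] at hbernoulli
  calc 2 * p ^ (p + 1) = (p ^ p + p ^ p) * p := by ring
    _ ≤ (p + 1) ^ p * (p + 1) := Nat.mul_le_mul hbernoulli p.le_succ
    _ = (p + 1) ^ (p + 1) := (pow_succ _ _).symm

theorem mul_pow_lt_succ_pow {p m d N : ℕ} (hN : N < 2 ^ m) (hd : (p + 1) * m ≤ d) :
    N * p ^ d < (p + 1) ^ d := by
  have hbase : 2 ^ m * p ^ ((p + 1) * m) ≤ (p + 1) ^ ((p + 1) * m) := by
    rw [pow_mul, pow_mul, ← mul_pow]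
    exact Nat.pow_le_pow_left (two_mul_pow_le_succ_pow p) m
  have hpow : 2 ^ m * p ^ d ≤ (p + 1) ^ d := by
    obtain ⟨e, rfl⟩ := Nat.exists_eq_add_of_le hd
    rw [pow_add, pow_add, ← mul_assoc]
    exact Nat.mul_le_mul hbase (Nat.pow_le_pow_left p.le_succ e)
  rcases (p ^ d).eq_zero_or_pos with h0 | h0
  · rw [h0, mul_zero]
    positivity
  · exact (Nat.mul_lt_mul_of_pos_right hN h0).trans_le hpow

section Colouring

variable {V : Type*} [Fintype V]

open Classical in
theorem card_colorings_avoiding (p : ℕ) (A : Finset V) (i : Fin (p + 1)) :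
    (Finset.univ.filter fun χ : V → Fin (p + 1) => ∀ a ∈ A, χ a ≠ i).card =
      p ^ A.card * (p + 1) ^ (Fintype.card V - A.card) := by
  have hpi : (Finset.univ.filter fun χ : V → Fin (p + 1) => ∀ a ∈ A, χ a ≠ i) =
      Fintype.piFinset fun a => if a ∈ A then {i}ᶜ else Finset.univ := by
    ext χ
    simp only [Finset.mem_filter, Finset.mem_univ, true_and, Fintype.mem_piFinset]
    refine forall_congr' fun a => ?_
    split_ifs with h <;> simp [h]
  have hfactor : ∀ a, (if a ∈ A then ({i}ᶜ : Finset (Fin (p + 1))) else Finset.univ).card =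
      if a ∈ A then p else p + 1 := by
    intro a
    split_ifs <;> simp [Finset.card_compl]
  rw [hpi, Fintype.card_piFinset, Finset.prod_congr rfl fun a _ => hfactor a,
    Finset.prod_ite, Finset.prod_const, Finset.prod_const, Finset.filter_mem_eq_inter,
    Finset.univ_inter, Finset.filter_notMem_eq_sdiff, ← Finset.compl_eq_univ_sdiff,
    Finset.card_compl]

open Classical in
theorem card_mul_card_colorings_avoiding_lt {p m : ℕ} (hm : Fintype.card V * (p + 1) < 2 ^ m)
    {A : Finset V} (hA : (p + 1) * m ≤ A.card) (i : Fin (p + 1)) :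
    Fintype.card V * (p + 1) *
      (Finset.univ.filter fun χ : V → Fin (p + 1) => ∀ a ∈ A, χ a ≠ i).card <
      (p + 1) ^ Fintype.card V := by
  rw [card_colorings_avoiding, ← mul_assoc]
  calc _ < (p + 1) ^ A.card * (p + 1) ^ (Fintype.card V - A.card) :=
        Nat.mul_lt_mul_of_pos_right (mul_pow_lt_succ_pow hm hA) (by positivity)
    _ = _ := by rw [← pow_add, Nat.add_sub_cancel' (Finset.card_le_univ A)]

/-- The union bound: each of the `|V| * Q` pairs of a large set and a colour it misses rules out
fewer than one colouring in `|V| * Q`. -/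
theorem exists_coloring_seeing_all {Q m : ℕ} (hm : Fintype.card V * Q < 2 ^ m) (hQ : 0 < Q)
    (A : V → Finset V) :
    ∃ χ : V → Fin Q, ∀ v, Q * m ≤ (A v).card → ∀ i, ∃ a ∈ A v, χ a = i := by
  classical
  obtain ⟨p, rfl⟩ := Nat.exists_eq_add_one.2 hQ
  by_contra! hmiss
  let bad : V × Fin (p + 1) → Finset (V → Fin (p + 1)) := fun q =>
    if (p + 1) * m ≤ (A q.1).card then
      Finset.univ.filter fun χ : V → Fin (p + 1) => ∀ a ∈ A q.1, χ a ≠ q.2 else ∅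
  have hcover : (Finset.univ : Finset (V → Fin (p + 1))) ⊆ Finset.univ.biUnion bad := by
    intro χ _
    obtain ⟨v, hv, i, hi⟩ := hmiss χ
    simp only [Finset.mem_biUnion, Finset.mem_univ, true_and]
    exact ⟨(v, i), by simpa [bad, hv] using hi⟩
  have hbad : ∀ q, Fintype.card V * (p + 1) * (bad q).card < (p + 1) ^ Fintype.card V := by
    intro q
    by_cases h : (p + 1) * m ≤ (A q.1).card
    · simpa only [bad, h, if_true] using card_mul_card_colorings_avoiding_lt hm h q.2
    · simp [bad, h]
  have hle : (p + 1) ^ Fintype.card V ≤ ∑ q, (bad q).card := by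
    calc _ = (Finset.univ : Finset (V → Fin (p + 1))).card := by simp
      _ ≤ _ := (Finset.card_le_card hcover).trans Finset.card_biUnion_le
  obtain ⟨v, -⟩ := hmiss fun _ => 0
  have hlt : ∑ q, Fintype.card V * (p + 1) * (bad q).card <
      ∑ q : V × Fin (p + 1), (p + 1) ^ Fintype.card V :=
    Finset.sum_lt_sum_of_nonempty ⟨(v, 0), Finset.mem_univ _⟩ fun q _ => hbad q
  rw [← Finset.mul_sum, Finset.sum_const, Finset.card_univ, Fintype.card_prod, Fintype.card_fin,
    smul_eq_mul] at hlt
  exact hle.not_gt (Nat.lt_of_mul_lt_mul_left hlt)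

theorem exists_small_classes {Q : ℕ} (hQ : Fintype.card V ≤ Q * Q) :
    ∃ κ : V → Fin Q, ∀ i, ∀ S : Finset V, (∀ x ∈ S, κ x = i) → S.card ≤ Q := by
  let e := Fintype.equivFin V
  refine ⟨fun x => ⟨e x / Q, Nat.div_lt_of_lt_mul ((e x).2.trans_le hQ)⟩, fun i S hS => ?_⟩
  have hmaps : Set.MapsTo (fun x => (e x : ℕ)) S (Finset.Ico (i * Q) (i * Q + Q)) := by
    intro x hx
    have hi : (e x : ℕ) / Q = i := congrArg Fin.val (hS x hx)
    rw [Finset.mem_coe, Finset.mem_Ico, ← hi]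
    exact ⟨Nat.div_mul_le_self _ _, Nat.lt_div_mul_add i.pos⟩
  have hinj : Set.InjOn (fun x => (e x : ℕ)) S := (Fin.val_injective.comp e.injective).injOn
  simpa using Finset.card_le_card_of_injOn _ hmaps hinj

end Colouring

/-! ### Copies of a pattern -/

/-- A pattern on the vertices `W` tells, for each pair of vertices, which truth values the adjacency
of their images may take. Subgraphs and induced subgraphs are both copies of patterns. -/
structure Pattern (W : Type*) where
  Allows : W → W → Prop → Prop

/-- The restriction of `φ` to `T` is a copy of the restriction of the pattern `P` to `T`. -/
structure Pattern.IsCopyOn {W α : Type*} (P : Pattern W) (adj : α → α → Prop) (T : Set W)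
    (φ : W → α) : Prop where
  injOn : Set.InjOn φ T
  pairwise : T.Pairwise fun a b => P.Allows a b (adj (φ a) (φ b))

/-- There is a copy of the pattern all of whose pairs of vertices are visible. -/
def Pattern.HasVisibleCopy {W α : Type*} (P : Pattern W) (adj visible : α → α → Prop) : Prop :=
  ∃ φ : W → α, (Pairwise fun a b => visible (φ a) (φ b)) ∧ P.IsCopyOn adj Set.univ φ

/-- The pattern whose copies are the copies of `H` as a subgraph. -/
def subgraphPattern {W : Type*} (H : SimpleGraph W) : Pattern W :=
  ⟨fun a b q => H.Adj a b → q⟩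

/-- The pattern whose copies are the copies of `H` as an induced subgraph. -/
def inducedPattern {W : Type*} (H : SimpleGraph W) : Pattern W :=
  ⟨fun a b q => H.Adj a b ↔ q⟩

section Copies

variable {V W α : Type*} {P : Pattern W}

theorem isContained_iff_exists_isCopyOn {H : SimpleGraph W} {G : SimpleGraph V} :
    H.IsContained G ↔ ∃ f, (subgraphPattern H).IsCopyOn G.Adj Set.univ f := by
  constructor
  · rintro ⟨f⟩
    exact ⟨f, f.injective.injOn, fun a _ b _ _ hab => f.toHom.map_adj hab⟩
  · rintro ⟨f, hf⟩
    exact ⟨⟨⟨f, fun hab => hf.pairwise trivial trivial hab.ne hab⟩, Set.injOn_univ.1 hf.injOn⟩⟩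

theorem isIndContained_iff_exists_isCopyOn {H : SimpleGraph W} {G : SimpleGraph V} :
    H.IsIndContained G ↔ ∃ f, (inducedPattern H).IsCopyOn G.Adj Set.univ f := by
  constructor
  · rintro ⟨f⟩
    exact ⟨f, f.injective.injOn, fun a _ b _ _ => f.map_adj_iff.symm⟩
  · rintro ⟨f, hf⟩
    refine ⟨⟨f, Set.injOn_univ.1 hf.injOn⟩, fun {a b} => ?_⟩
    rcases eq_or_ne a b with rfl | hab
    · simp
    · exact (hf.pairwise trivial trivial hab).symm

theorem Pattern.isCopyOn_comp_iff {adj : V → V → Prop} {adj' : α → α → Prop} {e : V → α}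
    (he : Function.Injective e) {T : Set W} {φ : W → V}
    (hadj : T.Pairwise fun a b => adj' (e (φ a)) (e (φ b)) ↔ adj (φ a) (φ b)) :
    P.IsCopyOn adj' T (e ∘ φ) ↔ P.IsCopyOn adj T φ := by
  have hallows : ∀ a ∈ T, ∀ b ∈ T, a ≠ b → (P.Allows a b (adj' (e (φ a)) (e (φ b))) ↔
      P.Allows a b (adj (φ a) (φ b))) := fun a ha b hb hab =>
    iff_of_eq (congrArg (P.Allows a b) (propext (hadj ha hb hab)))
  exact ⟨fun h => ⟨h.injOn.of_comp, fun a ha b hb hab =>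
      (hallows a ha b hb hab).1 (h.pairwise ha hb hab)⟩,
    fun h => ⟨he.comp_injOn h.injOn, fun a ha b hb hab =>
      (hallows a ha b hb hab).2 (h.pairwise ha hb hab)⟩⟩

theorem Pattern.hasVisibleCopy_iff_of_bijective {adj visible : V → V → Prop}
    {adj' visible' : α → α → Prop} {e : V → α} (he : Function.Bijective e)
    (hvis : ∀ y z, visible' (e y) (e z) ↔ visible y z)
    (hadj : ∀ y z, visible y z → (adj' (e y) (e z) ↔ adj y z)) :
    P.HasVisibleCopy adj' visible' ↔ P.HasVisibleCopy adj visible := by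
  rw [HasVisibleCopy, he.surjective.comp_left.exists]
  simp only [Function.comp_apply, hvis]
  exact exists_congr fun φ => and_congr_right fun hφ =>
    P.isCopyOn_comp_iff he.injective fun a _ b _ hab => hadj _ _ (hφ hab)

end Copies

/-! ### Zonings and the replacement of the low levels of a copy -/

/-- A division of the vertices into zones, named by their labels, and into levels. The level of a
vertex stands for its distance, cut off at the verification radius, to the vertices of high degree,
and the zones are the connected pieces of the neighbourhood of these vertices. -/
structure Zoning (α : Type*) where
  label : α → ℕ
  level : α → ℕ

namespace Zoning

variable {V α : Type*}

/-- The zoning induced on the source of a function. -/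
def comap (Z : Zoning α) (e : V → α) : Zoning V := ⟨Z.label ∘ e, Z.level ∘ e⟩

/-- The part below level `j` of the zone `l`. -/
def below (Z : Zoning α) (l j : ℕ) : Set α := {y | Z.label y = l ∧ Z.level y < j}

/-- The pairs of vertices whose adjacency is public: all of them, except for those pairs of vertices
of level `0` of the same zone that do not satisfy `K`. -/
def Known (Z : Zoning α) (K : α → α → Prop) (a b : α) : Prop :=
  Z.level a ≠ 0 ∨ Z.level b ≠ 0 ∨ Z.label a ≠ Z.label b ∨ K a b

/-- The pairs of vertices whose adjacency is known to `x`: besides the public ones, a vertex of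
level `0` knows the pairs inside its own zone. -/
def Visible (Z : Zoning α) (K : α → α → Prop) (x a b : α) : Prop :=
  Z.Known K a b ∨ (Z.level x = 0 ∧ Z.label a = Z.label x)

/-- Adjacent vertices are at most one level apart, and the zones are closed under adjacency below
level `k - 1`. -/
structure IsCompatible (Z : Zoning V) (k : ℕ) (G : SimpleGraph V) : Prop where
  label_eq : ∀ {x y}, G.Adj x y → Z.level x + 2 ≤ k → Z.label y = Z.label x
  level_le : ∀ {x y}, G.Adj x y → Z.level y ≤ Z.level x + 1

theorem below_mono (Z : Zoning V) (l : ℕ) : Monotone (Z.below l) :=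
  fun _ _ hij _ hy => ⟨hy.1, hy.2.trans_le hij⟩

theorem IsCompatible.not_adj {Z : Zoning V} {k : ℕ} {G : SimpleGraph V} (hZ : Z.IsCompatible k G)
    {l j : ℕ} (hj : j < k) {y z : V} (hy : y ∈ Z.below l j) (hz : z ∉ Z.below l (j + 1)) :
    ¬ G.Adj y z := by
  intro hyz
  have hlevel := hy.2
  have hle := hZ.level_le hyz
  exact hz ⟨(hZ.label_eq hyz (by omega)).trans hy.1, by omega⟩

end Zoning

namespace Pattern

variable {V W α : Type*} {P : Pattern W} {k : ℕ}

/-- The restriction of `φ` to `S ∪ R` is a copy in which `S` lies below level `j` in the zone of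
`c`, and in which `R` is sent to `c`, a vertex on level `j`. -/
structure IsRootedCopy (P : Pattern W) (Z : Zoning α) (adj : α → α → Prop) (j : ℕ) (S R : Set W)
    (c : α) (φ : W → α) : Prop where
  below : ∀ a ∈ S, φ a ∈ Z.below (Z.label c) j
  root : ∀ a ∈ R, φ a = c ∧ Z.level c = j
  isCopyOn : P.IsCopyOn adj (S ∪ R) φ

/-- Each rooted copy in the zone `l` can be replaced by one whose pairs of vertices are known. -/
def HasRepresentatives (P : Pattern W) (k : ℕ) (Z : Zoning α) (adj known : α → α → Prop) (l : ℕ) :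
    Prop :=
  ∀ j < k, ∀ S R : Set W, ∀ c, Z.label c = l → ∀ φ, P.IsRootedCopy Z adj j S R c φ →
    ∃ φ', P.IsRootedCopy Z adj j S R c φ' ∧ S.Pairwise fun a b => known (φ' a) (φ' b)

theorem IsRootedCopy.label_eq {Z : Zoning α} {adj : α → α → Prop} {j : ℕ} {S R : Set W} {c : α}
    {φ : W → α} (h : P.IsRootedCopy Z adj j S R c φ) {a : W} (ha : a ∈ S ∪ R) :
    Z.label (φ a) = Z.label c :=
  ha.elim (fun hS => (h.below a hS).1) fun hR => congrArg Z.label (h.root a hR).1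

theorem isRootedCopy_comp_iff {Z : Zoning α} {adj : V → V → Prop} {adj' : α → α → Prop} {e : V → α}
    (he : Function.Injective e) {c : V}
    (hadj : ∀ y z, Z.label (e y) = Z.label (e c) → Z.label (e z) = Z.label (e c) →
      (adj' (e y) (e z) ↔ adj y z)) {j : ℕ} {S R : Set W} {φ : W → V} :
    P.IsRootedCopy Z adj' j S R (e c) (e ∘ φ) ↔ P.IsRootedCopy (Z.comap e) adj j S R c φ := by
  constructor
  · intro h
    have hroot : ∀ a ∈ R, φ a = c ∧ Z.level (e c) = j := fun a ha =>
      ⟨he (h.root a ha).1, (h.root a ha).2⟩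
    exact ⟨h.below, hroot, (isCopyOn_comp_iff he fun a ha b hb _ =>
      hadj _ _ (h.label_eq ha) (h.label_eq hb)).1 h.isCopyOn⟩
  · intro h
    have hroot : ∀ a ∈ R, e (φ a) = e c ∧ Z.level (e c) = j := fun a ha =>
      ⟨congrArg e (h.root a ha).1, (h.root a ha).2⟩
    exact ⟨h.below, hroot, (isCopyOn_comp_iff he fun a ha b hb _ =>
      hadj _ _ (h.label_eq ha) (h.label_eq hb)).2 h.isCopyOn⟩

theorem hasRepresentatives_iff_of_bijective {Z : Zoning α} {adj known : V → V → Prop}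
    {adj' known' : α → α → Prop} {e : V → α} (he : Function.Bijective e) {l : ℕ}
    (hknown : ∀ y z, known' (e y) (e z) ↔ known y z)
    (hadj : ∀ y z, Z.label (e y) = l → Z.label (e z) = l → (adj' (e y) (e z) ↔ adj y z)) :
    P.HasRepresentatives k Z adj' known' l ↔ P.HasRepresentatives k (Z.comap e) adj known l := by
  refine forall₂_congr fun j _ => forall₂_congr fun S R => ?_
  rw [he.surjective.forall]
  refine forall₂_congr fun c hc => ?_
  subst hc
  rw [he.surjective.comp_left.forall]
  refine forall_congr' fun φ => imp_congr (isRootedCopy_comp_iff he.injective hadj) ?_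
  rw [he.surjective.comp_left.exists]
  simp only [Function.comp_apply, hknown]
  exact exists_congr fun φ' => and_congr_left fun _ => isRootedCopy_comp_iff he.injective hadj

/-- The copy `f` has at most one vertex on some level below `k` of the zone `l`. -/
def IsThin (k : ℕ) (Z : Zoning V) (f : W → V) (l : ℕ) : Prop :=
  ∃ j < k, {a | Z.label (f a) = l ∧ Z.level (f a) = j}.Subsingleton

/-- The function `φ` can take the place of `f` below level `j` of the zone `l`. -/
structure IsReplacement (P : Pattern W) (adj : V → V → Prop) (Z : Zoning V) (f : W → V) (l j : ℕ)
    (φ : W → V) : Prop where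
  below : ∀ a, f a ∈ Z.below l j → φ a ∈ Z.below l j
  eq_of_level_eq : ∀ a, Z.label (f a) = l → Z.level (f a) = j → φ a = f a
  isCopyOn : P.IsCopyOn adj (f ⁻¹' Z.below l (j + 1)) φ

open Classical in
/-- The function obtained from `f` by using `φ l` below level `j l` of each zone `l`. -/
noncomputable def replaceBelow (Z : Zoning V) (j : ℕ → ℕ) (φ : ℕ → W → V) (f : W → V) (a : W) : V :=
  if f a ∈ Z.below (Z.label (f a)) (j (Z.label (f a))) then φ (Z.label (f a)) a else f a

section Replacement

variable {Z : Zoning V} {G : SimpleGraph V} {adj : V → V → Prop} {K : V → V → Prop} {f : W → V}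

theorem IsCopyOn.isReplacement (hf : P.IsCopyOn adj Set.univ f) (l j : ℕ) :
    P.IsReplacement adj Z f l j f where
  below _ ha := ha
  eq_of_level_eq _ _ _ := rfl
  isCopyOn := ⟨hf.injOn.mono (Set.subset_univ _), hf.pairwise.mono (Set.subset_univ _)⟩

section

variable {j : ℕ → ℕ} {φ : ℕ → W → V}

theorem replaceBelow_of_mem (hφ : ∀ l, P.IsReplacement adj Z f l (j l) (φ l)) {l : ℕ} {a : W}
    (ha : f a ∈ Z.below l (j l + 1)) : replaceBelow Z j φ f a = φ l a := by
  obtain ⟨rfl, hlt⟩ := ha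
  rw [replaceBelow]
  split_ifs with h
  · rfl
  · have hge : j (Z.label (f a)) ≤ Z.level (f a) := not_lt.1 fun hlt => h ⟨rfl, hlt⟩
    exact ((hφ _).eq_of_level_eq a rfl (by omega)).symm

theorem replaceBelow_of_le {a : W} (ha : j (Z.label (f a)) ≤ Z.level (f a)) :
    replaceBelow Z j φ f a = f a :=
  if_neg fun h => h.2.not_ge ha

theorem level_replaceBelow_ne_zero {l : ℕ} {a : W} (hl : Z.label (f a) = l)
    (ha : f a ∉ Z.below l (j l + 1)) : Z.level (replaceBelow Z j φ f a) ≠ 0 := by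
  subst hl
  have hlt : j (Z.label (f a)) < Z.level (f a) :=
    not_le.1 fun hle => ha ⟨rfl, Nat.lt_succ_of_le hle⟩
  rw [replaceBelow_of_le hlt.le]
  exact Nat.ne_zero_of_lt hlt

theorem label_replaceBelow (hφ : ∀ l, P.IsReplacement adj Z f l (j l) (φ l)) (a : W) :
    Z.label (replaceBelow Z j φ f a) = Z.label (f a) := by
  rw [replaceBelow]
  split_ifs with h
  · exact ((hφ _).below a h).1
  · rfl

theorem separated_replaceBelow (hZ : Z.IsCompatible k G) (hj : ∀ l, j l < k)
    (hφ : ∀ l, P.IsReplacement adj Z f l (j l) (φ l)) {l : ℕ} {a b : W}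
    (ha : f a ∈ Z.below l (j l)) (hb : f b ∉ Z.below l (j l + 1)) :
    ¬ G.Adj (f a) (f b) ∧ ¬ G.Adj (replaceBelow Z j φ f a) (replaceBelow Z j φ f b) ∧
      replaceBelow Z j φ f a ≠ replaceBelow Z j φ f b := by
  have ha' : replaceBelow Z j φ f a ∈ Z.below l (j l) := by
    rw [replaceBelow_of_mem hφ (Z.below_mono l (Nat.le_succ _) ha)]
    exact (hφ l).below a ha
  have hb' : replaceBelow Z j φ f b ∉ Z.below l (j l + 1) := by
    intro h
    obtain rfl : Z.label (f b) = l := (label_replaceBelow hφ b).symm.trans h.1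
    rw [replaceBelow_of_le (not_lt.1 fun hlt => hb ⟨rfl, by omega⟩)] at h
    exact hb h
  refine ⟨hZ.not_adj (hj l) ha hb, hZ.not_adj (hj l) ha' hb', fun h => hb' ?_⟩
  exact h ▸ Z.below_mono l (Nat.le_succ _) ha'

theorem isCopyOn_replaceBelow (hf : P.IsCopyOn G.Adj Set.univ f) (hZ : Z.IsCompatible k G)
    (hj : ∀ l, j l < k) (hφ : ∀ l, P.IsReplacement G.Adj Z f l (j l) (φ l)) :
    P.IsCopyOn G.Adj Set.univ (replaceBelow Z j φ f) := by
  suffices h : ∀ a b, a ≠ b → replaceBelow Z j φ f a ≠ replaceBelow Z j φ f b ∧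
      P.Allows a b (G.Adj (replaceBelow Z j φ f a) (replaceBelow Z j φ f b)) from
    ⟨fun a _ b _ => not_imp_not.1 fun hab => (h a b hab).1, fun a _ b _ hab => (h a b hab).2⟩
  intro a b hab
  have hold := hf.pairwise trivial trivial hab
  by_cases ha : f a ∈ Z.below (Z.label (f a)) (j (Z.label (f a)))
  · by_cases hb : f b ∈ Z.below (Z.label (f a)) (j (Z.label (f a)) + 1)
    · have ha' := Z.below_mono _ (Nat.le_succ _) ha
      rw [replaceBelow_of_mem hφ ha', replaceBelow_of_mem hφ hb]
      exact ⟨(hφ _).isCopyOn.injOn.ne ha' hb hab, (hφ _).isCopyOn.pairwise ha' hb hab⟩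
    · obtain ⟨hadj, hadj', hne⟩ := separated_replaceBelow hZ hj hφ ha hb
      exact ⟨hne, by rwa [propext (iff_of_false hadj' hadj)]⟩
  by_cases hb : f b ∈ Z.below (Z.label (f b)) (j (Z.label (f b)))
  · by_cases ha' : f a ∈ Z.below (Z.label (f b)) (j (Z.label (f b)) + 1)
    · have hb' := Z.below_mono _ (Nat.le_succ _) hb
      rw [replaceBelow_of_mem hφ ha', replaceBelow_of_mem hφ hb']
      exact ⟨(hφ _).isCopyOn.injOn.ne ha' hb' hab, (hφ _).isCopyOn.pairwise ha' hb' hab⟩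
    · obtain ⟨hadj, hadj', hne⟩ := separated_replaceBelow hZ hj hφ hb ha'
      rw [G.adj_comm] at hadj hadj'
      exact ⟨hne.symm, by rwa [propext (iff_of_false hadj' hadj)]⟩
  · rw [replaceBelow, if_neg ha, replaceBelow, if_neg hb]
    exact ⟨hf.injOn.ne trivial trivial hab, hold⟩

end

theorem exists_isReplacement_known (hf : P.IsCopyOn G.Adj Set.univ f) {l : ℕ}
    (hrep : ∀ x, Z.level x = 0 → P.HasRepresentatives k Z G.Adj (Z.Known K) (Z.label x))
    (hl : IsThin k Z f l) :
    ∃ j < k, ∃ φ, P.IsReplacement G.Adj Z f l j φ ∧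
      (f ⁻¹' Z.below l (j + 1)).Pairwise fun a b => Z.Known K (φ a) (φ b) := by
  obtain ⟨j, hjk, hj⟩ := hl
  by_cases hlow : ∃ a, Z.label (f a) = l ∧ Z.level (f a) = 0
  swap
  · push Not at hlow
    exact ⟨j, hjk, f, hf.isReplacement l j, fun a ha b _ _ => .inl (hlow a ha.1)⟩
  obtain ⟨a₀, rfl, ha₀⟩ := hlow
  set l := Z.label (f a₀)
  set R : Set W := {a | Z.label (f a) = l ∧ Z.level (f a) = j}
  obtain ⟨c, hc, hcR⟩ : ∃ c, Z.label c = l ∧ ∀ a ∈ R, f a = c ∧ Z.level c = j := by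
    rcases R.eq_empty_or_nonempty with h | ⟨r, hr⟩
    · exact ⟨f a₀, rfl, by simp [h]⟩
    · exact ⟨f r, hr.1, fun a ha => ⟨congrArg f (hj ha hr), hr.2⟩⟩
  have hsplit : f ⁻¹' Z.below l (j + 1) = f ⁻¹' Z.below l j ∪ R := by
    ext a
    simp only [Set.mem_preimage, Set.mem_union, Zoning.below, R, Set.mem_ofPred_eq, ← and_or_left,
      Nat.lt_succ_iff_lt_or_eq]
  obtain ⟨φ, hφ, hknown⟩ := hrep (f a₀) ha₀ j hjk (f ⁻¹' Z.below l j) R c hc f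
    ⟨fun a ha => hc ▸ ha, hcR, hsplit ▸ (hf.isReplacement l j).isCopyOn⟩
  have hroot : ∀ a ∈ R, φ a = f a := fun a ha => (hφ.root a ha).1.trans (hcR a ha).1.symm
  refine ⟨j, hjk, φ, ⟨fun a ha => hc ▸ hφ.below a ha, fun a ha hja => hroot a ⟨ha, hja⟩,
    hsplit ▸ hφ.isCopyOn⟩, ?_⟩
  rw [hsplit]
  rintro a (ha | ha) b (hb | hb) hab
  · exact hknown ha hb hab
  · exact .inr (.inl (by rw [hroot b hb, hb.2]; exact Nat.ne_zero_of_lt ha.2))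
  · exact .inl (by rw [hroot a ha, ha.2]; exact Nat.ne_zero_of_lt hb.2)
  · exact absurd (hj ha hb) hab

theorem exists_copy_known (hk : 0 < k) (hf : P.IsCopyOn G.Adj Set.univ f)
    (hZ : Z.IsCompatible k G)
    (hrep : ∀ x, Z.level x = 0 → P.HasRepresentatives k Z G.Adj (Z.Known K) (Z.label x)) :
    ∃ f', P.IsCopyOn G.Adj Set.univ f' ∧ (∀ a, Z.label (f' a) = Z.label (f a)) ∧
      ∀ a b, a ≠ b → IsThin k Z f (Z.label (f a)) → Z.Known K (f' a) (f' b) := by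
  have hexists : ∀ l, ∃ j < k, ∃ φ, P.IsReplacement G.Adj Z f l j φ ∧ (IsThin k Z f l →
      (f ⁻¹' Z.below l (j + 1)).Pairwise fun a b => Z.Known K (φ a) (φ b)) := by
    intro l
    by_cases hl : IsThin k Z f l
    · obtain ⟨j, hj, φ, hφ, hknown⟩ := exists_isReplacement_known hf hrep hl
      exact ⟨j, hj, φ, hφ, fun _ => hknown⟩
    · exact ⟨0, hk, f, hf.isReplacement l 0, fun h => absurd h hl⟩
  choose j hj φ hφ hknown using hexists
  have hlabel := label_replaceBelow hφ
  refine ⟨replaceBelow Z j φ f, isCopyOn_replaceBelow hf hZ hj hφ, hlabel, fun a b hab hthin => ?_⟩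
  by_cases hl : Z.label (f b) = Z.label (f a)
  swap
  · exact .inr (.inr (.inl (by rwa [hlabel, hlabel, ne_comm])))
  by_cases ha : f a ∈ Z.below (Z.label (f a)) (j (Z.label (f a)) + 1)
  swap
  · exact .inl (level_replaceBelow_ne_zero rfl ha)
  by_cases hb : f b ∈ Z.below (Z.label (f a)) (j (Z.label (f a)) + 1)
  swap
  · exact .inr (.inl (level_replaceBelow_ne_zero hl hb))
  rw [replaceBelow_of_mem hφ ha, replaceBelow_of_mem hφ hb]
  exact hknown _ hthin ha hb hab

theorem le_card_of_not_isThin [Finite W] {l : ℕ} (hl : ¬ IsThin k Z f l) :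
    2 * k ≤ {a | Z.label (f a) = l}.ncard := by
  classical
  have := Fintype.ofFinite W
  by_contra! hlt
  obtain ⟨j, hj, hcard⟩ := Finset.exists_card_fiber_lt_of_card_lt_mul (t := Finset.range k) (n := 2)
    (s := Finset.univ.filter fun a => Z.label (f a) = l) (f := fun a => Z.level (f a)) (by
      rwa [Finset.card_range, mul_comm, ← Set.ncard_coe_finset, Finset.coe_filter_univ])
  refine hl ⟨j, Finset.mem_range.1 hj, fun a ha b hb => ?_⟩
  exact Finset.card_le_one.1 (Nat.le_of_lt_succ hcard) a (by simpa using ha) b (by simpa using hb)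

theorem isThin_or_isThin [Fintype W] (hW : Fintype.card W < 4 * k) {l l' : ℕ} (hl : l ≠ l') :
    IsThin k Z f l ∨ IsThin k Z f l' := by
  by_contra! hfat
  have hdisj : Disjoint {a | Z.label (f a) = l} {a | Z.label (f a) = l'} :=
    Set.disjoint_left.2 fun a ha ha' => hl (ha.symm.trans ha')
  have hcard := Set.ncard_le_card ({a | Z.label (f a) = l} ∪ {a | Z.label (f a) = l'})
  rw [Set.ncard_union_eq hdisj, Nat.card_eq_fintype_card] at hcard
  have h₁ := le_card_of_not_isThin hfat.1
  have h₂ := le_card_of_not_isThin hfat.2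
  omega

/-- At most one zone is not thin, and a vertex of level `0` in that zone sees all of it. -/
theorem exists_hasVisibleCopy [Fintype W] [Nonempty V] (hk : 0 < k) (hW : Fintype.card W < 4 * k)
    (hf : P.IsCopyOn G.Adj Set.univ f) (hZ : Z.IsCompatible k G)
    (hrep : ∀ x, Z.level x = 0 → P.HasRepresentatives k Z G.Adj (Z.Known K) (Z.label x)) :
    ∃ x, P.HasVisibleCopy G.Adj (Z.Visible K x) := by
  obtain ⟨f', hf', hlabel, hknown⟩ := exists_copy_known hk hf hZ hrep
  by_cases hfat : ∃ a, Z.level (f' a) = 0 ∧ ¬ IsThin k Z f (Z.label (f a))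
  · obtain ⟨a, ha, hthin⟩ := hfat
    refine ⟨f' a, f', fun b c hbc => ?_, hf'⟩
    rcases eq_or_ne (Z.label (f b)) (Z.label (f a)) with hba | hba
    · exact .inr ⟨ha, by rw [hlabel, hlabel, hba]⟩
    · exact .inl (hknown b c hbc ((isThin_or_isThin hW hba).resolve_right hthin))
  · push Not at hfat
    refine ⟨Classical.arbitrary V, f', fun b c hbc => .inl ?_, hf'⟩
    by_cases hb : Z.level (f' b) = 0
    · exact hknown b c hbc (hfat b hb)
    · exact .inl hb

end Replacement

end Pattern

/-! ### The verification algorithm -/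

namespace GlobalMap

/-- The identifiers that occur in the table of nodes. -/
def listed (g : GlobalMap) : Set ℕ := {a | ∃ t, (a, t) ∈ g.vertices}

/-- The label and the level of `a` in the table of nodes, which are arbitrary if `a` does not
occur in it. -/
noncomputable def entry (g : GlobalMap) (a : ℕ) : ℕ × ℕ :=
  Classical.epsilon fun t => (a, t) ∈ g.vertices

/-- The zoning read off from the table of nodes. -/
noncomputable def zoning (g : GlobalMap) : Zoning ℕ :=
  ⟨fun a => (g.entry a).1, fun a => (g.entry a).2⟩

/-- The pairs of nodes whose adjacency can be read off from the list of edges. -/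
def Known (g : GlobalMap) : ℕ → ℕ → Prop := g.zoning.Known fun a b => (a, b) ∈ g.known

/-- The pairs of nodes whose adjacency the node `me` can determine. -/
def Visible (g : GlobalMap) : ℕ → ℕ → ℕ → Prop := g.zoning.Visible fun a b => (a, b) ∈ g.known

/-- The adjacency according to the map and to a set `M` of gathered edges. -/
def Adjacent (g : GlobalMap) (M : Set (ℕ × ℕ)) (a b : ℕ) : Prop :=
  (a, b) ∈ g.edges ∨ (¬ g.Known a b ∧ (a, b) ∈ M)

/-- The tests that depend on the global map alone. The first one makes sure that the map lists no
nodes besides those of the network. -/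
structure IsConsistent (k : ℕ) (g : GlobalMap) : Prop where
  connected : ∀ a ∈ g.listed, ∀ b ∈ g.listed,
    Relation.ReflTransGen (fun a b => (a, b) ∈ g.edges) a b
  level_pred : ∀ a ∈ g.listed, 0 < g.zoning.level a → g.zoning.level a < k →
    ∃ b, (a, b) ∈ g.edges ∧ g.zoning.level b + 1 = g.zoning.level a
  zone_connected : ∀ a ∈ g.listed, ∀ b ∈ g.listed, g.zoning.label a = g.zoning.label b →
    Relation.ReflTransGen (fun a b => (a, b) ∈ g.edges ∧
      (g.zoning.level a + 2 ≤ k ∨ g.zoning.level b + 2 ≤ k)) a b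

/-- The tests that compare the global map with the neighbours `nb` of the node `a`. -/
structure IsLocallyCorrect (k : ℕ) (g : GlobalMap) (a : ℕ) (nb : Set ℕ) : Prop where
  mem_listed : a ∈ g.listed
  mem_edges_iff : ∀ b, (a, b) ∈ g.edges ↔ b ∈ nb ∧ g.Known a b
  label_eq : ∀ b ∈ nb, g.zoning.level a + 2 ≤ k → g.zoning.label b = g.zoning.label a
  level_le : ∀ b ∈ nb, g.zoning.level b ≤ g.zoning.level a + 1

end GlobalMap

/-- The tests for copies of the pattern at the node `me` with gathered edges `M`: it sees no copy,
and in its own zone the rooted copies have representatives. -/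
structure Pattern.IsExcludedBy {W : Type*} (P : Pattern W) (k : ℕ) (g : GlobalMap) (me : ℕ)
    (M : Set (ℕ × ℕ)) : Prop where
  no_copy : ¬ P.HasVisibleCopy (α := g.listed) (fun a b => g.Adjacent M a b)
    fun a b => g.Visible me a b
  representatives : g.zoning.level me = 0 → P.HasRepresentatives (α := g.listed) k
    (g.zoning.comap Subtype.val) (fun a b => g.Adjacent M a b) (fun a b => g.Known a b)
    (g.zoning.label me)

namespace LocalView

/-- The visible neighbours of a node. -/
def neighbors (w : LocalView) (a : ℕ) : Set ℕ := {b | (a, b) ∈ w.edges}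

/-- The nodes reached from the center by a visible walk of at most `i` edges. -/
def ball (w : LocalView) : ℕ → Set ℕ
  | 0 => {w.center}
  | i + 1 => w.ball i ∪ {b | ∃ a ∈ w.ball i, (a, b) ∈ w.edges}

/-- The union of the shares of the visible neighbours of `a`. -/
def gathered (w : LocalView) (a : ℕ) : Set (ℕ × ℕ) :=
  {p | ∃ b ct, (a, b) ∈ w.edges ∧ (b, ct) ∈ w.nodes ∧ p ∈ (Certificate.decode ct).share}

/-- The center accepts the view with `g` as the global map. It checks that the nodes of level `0` at
distance less than `k` gather the same edges, and its own row in them. -/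
structure AcceptsMap {W : Type*} (w : LocalView) (k : ℕ) (P : Pattern W) (g : GlobalMap) :
    Prop where
  map_eq : ∀ b ct, (b, ct) ∈ w.nodes → (Certificate.decode ct).map = g
  isConsistent : g.IsConsistent k
  isLocallyCorrect : g.IsLocallyCorrect k w.center (w.neighbors w.center)
  gathered_eq : ∀ a ∈ w.ball (k - 1), ∀ b ∈ w.ball (k - 1), g.zoning.level a = 0 →
    g.zoning.level b = 0 → w.gathered a = w.gathered b
  mem_gathered_iff : g.zoning.level w.center = 0 →
    ∀ b, (w.center, b) ∈ w.gathered w.center ↔ b ∈ w.neighbors w.center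
  isExcludedBy : P.IsExcludedBy k g w.center (w.gathered w.center)

/-- The verification algorithm. -/
def Accepts {W : Type*} (w : LocalView) (k : ℕ) (P : Pattern W) : Prop :=
  ∃ g, w.AcceptsMap k P g

end LocalView

/-! ### What is seen in a network -/

/-- The edges listed in the shares of the neighbours of `u`. -/
def gatheredEdges {V : Type*} (G : SimpleGraph V) (cert : V → List Bool) (u : V) : Set (ℕ × ℕ) :=
  {p | ∃ y, G.Adj u y ∧ p ∈ (Certificate.decode (cert y)).share}

section View

variable {V : Type*} {G : SimpleGraph V} {ident : V → ℕ} {k : ℕ}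

theorem edist_le_succ_of_adj {x y z : V} {i : ℕ} (h : G.edist x y ≤ i) (hyz : G.Adj y z) :
    G.edist x z ≤ (i + 1 : ℕ) :=
  calc G.edist x z ≤ G.edist x y + G.edist y z := G.edist_triangle
    _ ≤ i + 1 := add_le_add h (SimpleGraph.edist_eq_one_iff_adj.2 hyz).le
    _ = (i + 1 : ℕ) := (Nat.cast_succ i).symm

theorem edist_le_succ_iff {x z : V} {i : ℕ} :
    G.edist x z ≤ (i + 1 : ℕ) ↔ G.edist x z ≤ i ∨ ∃ y, G.edist x y ≤ i ∧ G.Adj y z := by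
  refine ⟨fun h => ?_, ?_⟩
  · obtain ⟨p, hp⟩ := SimpleGraph.exists_walk_of_edist_ne_top (ne_top_of_le_ne_top (by simp) h)
    have hlength : p.length ≤ i + 1 := by exact_mod_cast hp.trans_le h
    cases p using SimpleGraph.Walk.concatRec with
    | Hnil => exact .inl (by simp)
    | Hconcat p hyz =>
      rw [SimpleGraph.Walk.length_concat] at hlength
      exact .inr ⟨_, p.edist_le.trans (by exact_mod_cast Nat.le_of_succ_le_succ hlength), hyz⟩
  · rintro (h | ⟨y, hxy, hyz⟩)
    · exact h.trans (by exact_mod_cast i.le_succ)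
    · exact edist_le_succ_of_adj hxy hyz

variable {cert : V → List Bool} {x u : V} {i : ℕ}

theorem mem_edges_localView_iff (hid : Function.Injective ident) (hu : G.edist x u ≤ i)
    (hi : i < k) {b : ℕ} :
    (ident u, b) ∈ (localView G ident cert k x).edges ↔ ∃ y, G.Adj u y ∧ ident y = b := by
  simp only [localView, Set.mem_ofPred_eq, Prod.mk.injEq]
  constructor
  · rintro ⟨y, z, hyz, -, -, -, hy, rfl⟩
    obtain rfl := hid hy
    exact ⟨z, hyz, rfl⟩
  · rintro ⟨y, huy, rfl⟩
    have hik : (i : ℕ∞) < k := by exact_mod_cast hi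
    exact ⟨u, y, huy, hu.trans hik.le, (edist_le_succ_of_adj hu huy).trans (by exact_mod_cast hi),
      fun h => (hu.trans_lt hik).ne h.1, rfl, rfl⟩

theorem neighbors_localView (hid : Function.Injective ident) (hk : 0 < k) :
    (localView G ident cert k x).neighbors (ident x) = ident '' G.neighborSet x :=
  Set.ext fun _ => mem_edges_localView_iff (cert := cert) hid (i := 0) (by simp) hk

theorem ball_localView (hid : Function.Injective ident) (hi : i < k) :
    (localView G ident cert k x).ball i = ident '' {y | G.edist x y ≤ i} := by
  induction i with
  | zero =>
    simp only [LocalView.ball, localView, Nat.cast_zero, nonpos_iff_eq_zero,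
      SimpleGraph.edist_eq_zero_iff, Set.ofPred_eq_eq_singleton', Set.image_singleton]
  | succ i ih =>
    have hi' : i < k := Nat.lt_of_succ_lt hi
    ext b
    simp only [LocalView.ball, ih hi', Set.mem_union, Set.mem_image, Set.mem_ofPred_eq,
      edist_le_succ_iff]
    constructor
    · rintro (⟨y, hy, rfl⟩ | ⟨_, ⟨y, hy, rfl⟩, hyb⟩)
      · exact ⟨y, .inl hy, rfl⟩
      · obtain ⟨z, hyz, rfl⟩ := (mem_edges_localView_iff hid hy hi').1 hyb
        exact ⟨z, .inr ⟨y, hy, hyz⟩, rfl⟩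
    · rintro ⟨z, hz | ⟨y, hy, hyz⟩, rfl⟩
      · exact .inl ⟨z, hz, rfl⟩
      · exact .inr ⟨_, ⟨y, hy, rfl⟩, (mem_edges_localView_iff hid hy hi').2 ⟨z, hyz, rfl⟩⟩

theorem gathered_localView (hid : Function.Injective ident) (hu : G.edist x u ≤ i) (hi : i < k) :
    (localView G ident cert k x).gathered (ident u) = gatheredEdges G cert u := by
  ext p
  constructor
  · rintro ⟨b, ct, hub, ⟨z, -, hz⟩, hp⟩
    obtain ⟨y, hy, rfl⟩ := (mem_edges_localView_iff hid hu hi).1 hub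
    obtain ⟨hyz, rfl⟩ := Prod.mk.inj hz
    obtain rfl := hid hyz
    exact ⟨y, hy, hp⟩
  · rintro ⟨y, hy, hp⟩
    exact ⟨ident y, cert y, (mem_edges_localView_iff hid hu hi).2 ⟨y, hy, rfl⟩,
      ⟨y, (edist_le_succ_of_adj hu hy).trans (by exact_mod_cast hi), rfl⟩, hp⟩

end View

/-! ### Maps that are correct on a given network -/

namespace GlobalMap

/-- The map lists the nodes of the network, and it passes the tests that compare it with their
neighbourhoods. -/
structure IsCorrect {V : Type*} (k : ℕ) (g : GlobalMap) (G : SimpleGraph V) (ident : V → ℕ) :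
    Prop where
  listed_eq : g.listed = Set.range ident
  isLocallyCorrect : ∀ x, g.IsLocallyCorrect k (ident x) (ident '' G.neighborSet x)

/-- If `x` has level `0`, then `M` contains the right edges at the vertices of level `0` of the zone
of `x`. This is what the edges gathered by `x` are for. -/
def CoversZone {V : Type*} (g : GlobalMap) (G : SimpleGraph V) (ident : V → ℕ) (x : V)
    (M : Set (ℕ × ℕ)) : Prop :=
  g.zoning.level (ident x) = 0 → ∀ y z, g.zoning.level (ident y) = 0 →
    g.zoning.label (ident y) = g.zoning.label (ident x) → ((ident y, ident z) ∈ M ↔ G.Adj y z)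

namespace IsCorrect

variable {V W : Type*} {P : Pattern W} {G : SimpleGraph V} {ident : V → ℕ} {k : ℕ} {g : GlobalMap}
  {M : Set (ℕ × ℕ)}

theorem isCompatible (hg : g.IsCorrect k G ident) : (g.zoning.comap ident).IsCompatible k G where
  label_eq hxy hx := (hg.isLocallyCorrect _).label_eq _ ⟨_, hxy, rfl⟩ hx
  level_le hxy := (hg.isLocallyCorrect _).level_le _ ⟨_, hxy, rfl⟩

theorem mem_edges_iff (hg : g.IsCorrect k G ident) (hid : Function.Injective ident) {x y : V} :
    (ident x, ident y) ∈ g.edges ↔ G.Adj x y ∧ g.Known (ident x) (ident y) := by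
  rw [(hg.isLocallyCorrect x).mem_edges_iff, hid.mem_set_image, SimpleGraph.mem_neighborSet]

theorem bijective (hg : g.IsCorrect k G ident) (hid : Function.Injective ident) :
    Function.Bijective fun x => (⟨ident x, (hg.isLocallyCorrect x).mem_listed⟩ : g.listed) := by
  refine ⟨fun x y hxy => hid (congrArg Subtype.val hxy), fun ⟨a, ha⟩ => ?_⟩
  obtain ⟨x, rfl⟩ := hg.listed_eq ▸ ha
  exact ⟨x, rfl⟩

theorem adjacent_iff (hg : g.IsCorrect k G ident) (hid : Function.Injective ident) {x y z : V}
    (hM : g.CoversZone G ident x M) (hyz : g.Visible (ident x) (ident y) (ident z)) :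
    g.Adjacent M (ident y) (ident z) ↔ G.Adj y z := by
  by_cases hknown : g.Known (ident y) (ident z)
  · simp only [Adjacent, hg.mem_edges_iff hid, hknown, and_true, not_true_eq_false, false_and,
      or_false]
  · have hy : g.zoning.level (ident y) = 0 := by_contra fun h => hknown (.inl h)
    obtain ⟨hx, hlabel⟩ := hyz.resolve_left hknown
    simp only [Adjacent, hg.mem_edges_iff hid, hknown, and_false, not_false_eq_true, true_and,
      false_or, hM hx y z hy hlabel]

theorem isExcludedBy_iff (hg : g.IsCorrect k G ident) (hid : Function.Injective ident) {x : V}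
    (hM : g.CoversZone G ident x M) :
    P.IsExcludedBy k g (ident x) M ↔
      ¬ P.HasVisibleCopy G.Adj
        ((g.zoning.comap ident).Visible (fun y z => (ident y, ident z) ∈ g.known) x) ∧
      (g.zoning.level (ident x) = 0 → P.HasRepresentatives k (g.zoning.comap ident) G.Adj
        ((g.zoning.comap ident).Known fun y z => (ident y, ident z) ∈ g.known)
        (g.zoning.label (ident x))) := by
  let e := fun y => (⟨ident y, (hg.isLocallyCorrect y).mem_listed⟩ : g.listed)
  have he : Function.Bijective e := hg.bijective hid
  have hcopy : P.HasVisibleCopy (α := g.listed) (fun a b => g.Adjacent M a b)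
      (fun a b => g.Visible (ident x) a b) ↔ P.HasVisibleCopy G.Adj
        ((g.zoning.comap ident).Visible (fun y z => (ident y, ident z) ∈ g.known) x) :=
    P.hasVisibleCopy_iff_of_bijective he (fun _ _ => Iff.rfl) fun _ _ => hg.adjacent_iff hid hM
  have hrep := fun hx : g.zoning.level (ident x) = 0 =>
    P.hasRepresentatives_iff_of_bijective (k := k) (Z := g.zoning.comap Subtype.val) he
      (known := (g.zoning.comap ident).Known fun y z => (ident y, ident z) ∈ g.known)
      (known' := fun a b => g.Known a b) (adj := G.Adj) (adj' := fun a b => g.Adjacent M a b)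
      (fun _ _ => Iff.rfl) fun _ _ hy _ => hg.adjacent_iff hid hM (.inr ⟨hx, hy⟩)
  exact ⟨fun h => ⟨hcopy.not.1 h.no_copy, fun hx => (hrep hx).1 (h.representatives hx)⟩,
    fun h => ⟨hcopy.not.2 h.1, fun hx => (hrep hx).2 (h.2 hx)⟩⟩

end IsCorrect

end GlobalMap

/-! ### Soundness -/

section Soundness

variable {V W : Type*} {P : Pattern W} {G : SimpleGraph V} {ident : V → ℕ} {cert : V → List Bool}
  {k : ℕ} {g : GlobalMap}

theorem exists_common_map (hk : 0 < k) (hG : G.Connected)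
    (hacc : ∀ x, (localView G ident cert k x).Accepts k P) :
    ∃ g, ∀ x, (localView G ident cert k x).AcceptsMap k P g := by
  choose m hm using hacc
  have hmap : ∀ x y, G.edist x y ≤ k → (Certificate.decode (cert y)).map = m x :=
    fun x y hxy => (hm x).map_eq _ _ ⟨y, hxy, rfl⟩
  have hself : ∀ x, (Certificate.decode (cert x)).map = m x := fun x => hmap x x (by simp)
  have hadj : ∀ x y, G.Adj x y → m x = m y := fun x y hxy =>
    (hmap x y ((SimpleGraph.edist_eq_one_iff_adj.2 hxy).trans_le (by exact_mod_cast hk))).symm.trans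
      (hself y)
  obtain ⟨x₀⟩ := hG.nonempty
  refine ⟨m x₀, fun x => ?_⟩
  have hconst : m x₀ = m x := by
    obtain ⟨p⟩ := hG.preconnected x₀ x
    induction p with
    | nil => rfl
    | cons h _ ih => exact (hadj _ _ h).trans ih
  exact hconst ▸ hm x

theorem isLocallyCorrect_of_acceptsMap (hid : Function.Injective ident) (hk : 0 < k) {x : V}
    (hacc : (localView G ident cert k x).AcceptsMap k P g) :
    g.IsLocallyCorrect k (ident x) (ident '' G.neighborSet x) :=
  neighbors_localView (cert := cert) hid hk ▸ hacc.isLocallyCorrect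

theorem isCorrect_of_acceptsMap [Nonempty V] (hid : Function.Injective ident) (hk : 0 < k)
    (hacc : ∀ x, (localView G ident cert k x).AcceptsMap k P g) : g.IsCorrect k G ident := by
  have hlocal := fun x => isLocallyCorrect_of_acceptsMap hid hk (hacc x)
  refine ⟨Set.Subset.antisymm (fun a ha => ?_) (Set.range_subset_iff.2 fun x =>
    (hlocal x).mem_listed), hlocal⟩
  obtain ⟨x₀⟩ := ‹Nonempty V›
  have hpath := (hacc x₀).isConsistent.connected _ (hlocal x₀).mem_listed a ha
  clear ha
  induction hpath with
  | refl => exact ⟨x₀, rfl⟩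
  | tail _ hedge ih =>
    obtain ⟨y, rfl⟩ := ih
    obtain ⟨⟨z, -, rfl⟩, -⟩ := ((hlocal y).mem_edges_iff _).1 hedge
    exact ⟨z, rfl⟩

theorem exists_level_eq_zero_near (hg : g.IsCorrect k G ident)
    (hcons : g.IsConsistent k) {i : ℕ} (hi : i < k) {x : V} (hx : g.zoning.level (ident x) = i) :
    ∃ u, g.zoning.level (ident u) = 0 ∧ G.edist u x ≤ i := by
  induction i generalizing x with
  | zero => exact ⟨x, hx, by simp⟩
  | succ i ih =>
    obtain ⟨b, hedge, hb⟩ := hcons.level_pred _ (hg.isLocallyCorrect x).mem_listed (by omega)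
      (by omega)
    obtain ⟨⟨y, hxy, rfl⟩, -⟩ := ((hg.isLocallyCorrect x).mem_edges_iff _).1 hedge
    obtain ⟨u, hu, huy⟩ := ih (by omega) (x := y) (by omega)
    exact ⟨u, hu, edist_le_succ_of_adj huy hxy.symm⟩

theorem exists_level_eq_zero_near_edge (hg : g.IsCorrect k G ident) (hcons : g.IsConsistent k)
    {x y : V} (hxy : G.Adj x y) (hx : g.zoning.level (ident x) + 2 ≤ k) :
    ∃ u, g.zoning.level (ident u) = 0 ∧ G.edist u x ≤ (k - 1 : ℕ) ∧ G.edist u y ≤ (k - 1 : ℕ) := by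
  obtain ⟨u, hu, hux⟩ := exists_level_eq_zero_near hg hcons (by omega) (x := x) rfl
  exact ⟨u, hu, hux.trans (by exact_mod_cast (by omega)),
    (edist_le_succ_of_adj hux hxy).trans (by exact_mod_cast (by omega))⟩

theorem gatheredEdges_eq_of_acceptsMap (hid : Function.Injective ident) (hk : 0 < k)
    (hacc : ∀ x, (localView G ident cert k x).AcceptsMap k P g) {x u v : V}
    (hu : g.zoning.level (ident u) = 0) (hv : g.zoning.level (ident v) = 0)
    (hux : G.edist u x ≤ (k - 1 : ℕ)) (hvx : G.edist v x ≤ (k - 1 : ℕ)) :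
    gatheredEdges G cert u = gatheredEdges G cert v := by
  have hk' : k - 1 < k := Nat.sub_one_lt_of_lt hk
  rw [SimpleGraph.edist_comm] at hux hvx
  have heq := (hacc x).gathered_eq (ident u) (by rw [ball_localView hid hk']; exact ⟨u, hux, rfl⟩)
    (ident v) (by rw [ball_localView hid hk']; exact ⟨v, hvx, rfl⟩) hu hv
  rwa [gathered_localView hid hux hk', gathered_localView hid hvx hk'] at heq

/-- The agreement is carried along the zone, from an edge to the next one. -/
theorem gatheredEdges_eq_of_label_eq [Nonempty V] (hid : Function.Injective ident) (hk : 0 < k)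
    (hacc : ∀ x, (localView G ident cert k x).AcceptsMap k P g) {x y : V}
    (hx : g.zoning.level (ident x) = 0) (hy : g.zoning.level (ident y) = 0)
    (hxy : g.zoning.label (ident x) = g.zoning.label (ident y)) :
    gatheredEdges G cert x = gatheredEdges G cert y := by
  have hg := isCorrect_of_acceptsMap hid hk hacc
  have hcons := (hacc x).isConsistent
  suffices h : ∀ a, Relation.ReflTransGen (fun a b => (a, b) ∈ g.edges ∧
      (g.zoning.level a + 2 ≤ k ∨ g.zoning.level b + 2 ≤ k)) (ident x) a →
      ∃ z, ident z = a ∧ ∀ v, g.zoning.level (ident v) = 0 → G.edist v z ≤ (k - 1 : ℕ) →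
        gatheredEdges G cert x = gatheredEdges G cert v by
    obtain ⟨z, hz, hgathered⟩ := h _ (hcons.zone_connected _ (hg.isLocallyCorrect x).mem_listed _
      (hg.isLocallyCorrect y).mem_listed hxy)
    obtain rfl := hid hz
    exact hgathered z hy (by simp)
  intro a hpath
  induction hpath with
  | refl =>
    exact ⟨x, rfl, fun v hv hvx => gatheredEdges_eq_of_acceptsMap hid hk hacc hx hv (by simp) hvx⟩
  | tail _ hedge ih =>
    obtain ⟨z, rfl, hz⟩ := ih
    obtain ⟨⟨z', hzz', rfl⟩, -⟩ := ((hg.isLocallyCorrect z).mem_edges_iff _).1 hedge.1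
    refine ⟨z', rfl, fun v hv hvz' => ?_⟩
    obtain ⟨u, hu, huz, huz'⟩ : ∃ u, g.zoning.level (ident u) = 0 ∧ G.edist u z ≤ (k - 1 : ℕ) ∧
        G.edist u z' ≤ (k - 1 : ℕ) := by
      rcases hedge.2 with hlevel | hlevel
      · exact exists_level_eq_zero_near_edge hg hcons hzz' hlevel
      · obtain ⟨u, hu, hz', hz⟩ := exists_level_eq_zero_near_edge hg hcons hzz'.symm hlevel
        exact ⟨u, hu, hz, hz'⟩
    exact (hz u hu huz).trans (gatheredEdges_eq_of_acceptsMap hid hk hacc hu hv huz' hvz')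

theorem coversZone_of_acceptsMap [Nonempty V] (hid : Function.Injective ident) (hk : 0 < k)
    (hacc : ∀ x, (localView G ident cert k x).AcceptsMap k P g) (x : V) :
    g.CoversZone G ident x (gatheredEdges G cert x) := by
  intro hx y z hy hyx
  rw [gatheredEdges_eq_of_label_eq hid hk hacc hx hy hyx.symm,
    ← gathered_localView (x := y) (i := 0) hid (by simp) hk]
  have hrow := (hacc y).mem_gathered_iff hy (ident z)
  rwa [show (localView G ident cert k y).center = ident y from rfl, neighbors_localView hid hk,
    hid.mem_set_image, SimpleGraph.mem_neighborSet] at hrow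

theorem not_isCopyOn_of_accepts [Fintype W] (hk : 0 < k) (hW : Fintype.card W < 4 * k)
    (hG : G.Connected) (hid : Function.Injective ident)
    (hacc : ∀ x, (localView G ident cert k x).Accepts k P) (f : W → V) :
    ¬ P.IsCopyOn G.Adj Set.univ f := by
  intro hf
  have := hG.nonempty
  obtain ⟨g, hacc⟩ := exists_common_map hk hG hacc
  have hg := isCorrect_of_acceptsMap hid hk hacc
  have hexcluded : ∀ x, P.IsExcludedBy k g (ident x) (gatheredEdges G cert x) := fun x =>
    gathered_localView (x := x) (u := x) (i := 0) hid (by simp) hk ▸ (hacc x).isExcludedBy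
  have htests := fun x =>
    (hg.isExcludedBy_iff hid (coversZone_of_acceptsMap hid hk hacc x)).1 (hexcluded x)
  obtain ⟨x, hx⟩ := Pattern.exists_hasVisibleCopy hk hW hf hg.isCompatible fun x => (htests x).2
  exact (htests x).1 hx

end Soundness

/-! ### The zones around a set of vertices -/

/-- The graph of the edges of `G` with an end below level `k - 1`. Its components are the zones. -/
def zoneGraph {V : Type*} (G : SimpleGraph V) (level : V → ℕ) (k : ℕ) : SimpleGraph V where
  Adj x y := G.Adj x y ∧ (level x + 2 ≤ k ∨ level y + 2 ≤ k)
  symm := ⟨fun _ _ h => ⟨h.1.symm, h.2.symm⟩⟩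
  loopless := ⟨fun _ h => h.1.ne rfl⟩

/-- The distance from the set `A` to `x`, cut off at `k`. -/
noncomputable def cutDist {V : Type*} (G : SimpleGraph V) (A : Set V) (k : ℕ) (x : V) : ℕ :=
  sInf {i : ℕ | i = k ∨ ∃ u ∈ A, G.edist u x ≤ i}

/-- The zoning by the distance to `A`. A zone is labelled by the identifier of one of its vertices,
so that labels are short. -/
noncomputable def distanceZoning {V : Type*} (G : SimpleGraph V) (A : Set V) (k : ℕ)
    (ident : V → ℕ) : Zoning V where
  label x := ident ((zoneGraph G (cutDist G A k) k).connectedComponentMk x).out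
  level := cutDist G A k

section Zones

variable {V : Type*} {G : SimpleGraph V} {A : Set V} {k : ℕ} {ident : V → ℕ} {x y : V}

theorem cutDist_le : cutDist G A k x ≤ k :=
  Nat.sInf_le (.inl rfl)

theorem cutDist_le_iff {i : ℕ} (hi : i < k) :
    cutDist G A k x ≤ i ↔ ∃ u ∈ A, G.edist u x ≤ i := by
  refine ⟨fun h => ?_, fun h => Nat.sInf_le (.inr h)⟩
  rcases Nat.sInf_mem (s := {i : ℕ | i = k ∨ ∃ u ∈ A, G.edist u x ≤ i}) ⟨k, .inl rfl⟩ with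
    hk | ⟨u, hu, hux⟩
  · exact absurd (hk.symm.trans_le h) hi.not_ge
  · exact ⟨u, hu, hux.trans (by exact_mod_cast h)⟩

theorem cutDist_eq_zero_iff (hk : 0 < k) : cutDist G A k x = 0 ↔ x ∈ A := by
  rw [← Nat.le_zero, cutDist_le_iff hk]
  simp

theorem cutDist_le_succ (hxy : G.Adj x y) : cutDist G A k y ≤ cutDist G A k x + 1 := by
  by_cases hlt : cutDist G A k x + 1 < k
  · obtain ⟨u, hu, hux⟩ := (cutDist_le_iff (Nat.lt_of_succ_lt hlt)).1 le_rfl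
    exact (cutDist_le_iff hlt).2 ⟨u, hu, edist_le_succ_of_adj hux hxy⟩
  · exact cutDist_le.trans (not_lt.1 hlt)

theorem exists_adj_cutDist_succ_eq (h0 : 0 < cutDist G A k x) (hk : cutDist G A k x < k) :
    ∃ y, G.Adj x y ∧ cutDist G A k y + 1 = cutDist G A k x := by
  obtain ⟨i, hi⟩ := Nat.exists_eq_add_one.2 h0
  have hik : i < k := by omega
  obtain ⟨u, hu, hux⟩ := (cutDist_le_iff (hi ▸ hk)).1 hi.le
  rcases edist_le_succ_iff.1 hux with hux | ⟨y, huy, hyx⟩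
  · have hle := (cutDist_le_iff hik).2 ⟨u, hu, hux⟩
    omega
  · have hle := (cutDist_le_iff hik).2 ⟨u, hu, huy⟩
    have hge := cutDist_le_succ (A := A) (k := k) hyx
    exact ⟨y, hyx.symm, by omega⟩

theorem isCompatible_distanceZoning : (distanceZoning G A k ident).IsCompatible k G where
  label_eq {x y} hxy hx := by
    have hadj : (zoneGraph G (cutDist G A k) k).Adj x y := ⟨hxy, .inl hx⟩
    exact congrArg (fun C => ident (Quot.out C))
      (SimpleGraph.ConnectedComponent.sound hadj.symm.reachable)
  level_le := cutDist_le_succ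

theorem reachable_of_label_distanceZoning_eq (hid : Function.Injective ident)
    (hxy : (distanceZoning G A k ident).label x = (distanceZoning G A k ident).label y) :
    (zoneGraph G (cutDist G A k) k).Reachable x y :=
  SimpleGraph.ConnectedComponent.exact (Function.LeftInverse.injective Quot.out_eq (hid hxy))

end Zones

/-! ### Small sets of known pairs -/

/-- The pairs in `K` connect all the pairs of vertices that `G` connects. -/
def SpansComponents {V : Type*} (K : Finset (V × V)) (G : SimpleGraph V) : Prop :=
  ∀ x y, G.Reachable x y → Relation.ReflTransGen (fun a b => G.Adj a b ∧ (a, b) ∈ K) x y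

theorem SpansComponents.mono {V : Type*} {K K' : Finset (V × V)} {G : SimpleGraph V}
    (h : SpansComponents K G) (hK : K ⊆ K') : SpansComponents K' G :=
  fun x y hxy => Relation.ReflTransGen.mono (fun _ _ hab => ⟨hab.1, hK hab.2⟩) _ _ (h x y hxy)

theorem card_edgeFinset_le_of_isAcyclic {V : Type*} [Fintype V] {F : SimpleGraph V}
    [Fintype F.edgeSet] (hF : F.IsAcyclic) : F.edgeFinset.card ≤ Fintype.card V := by
  classical
  rcases isEmpty_or_nonempty V with hV | hV
  · simp [F.edgeFinset.eq_empty_of_isEmpty]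
  obtain ⟨T, hFT, -, hT⟩ :=
    (SimpleGraph.connected_top (V := V)).exists_isTree_le_of_le_of_isAcyclic le_top hF
  calc F.edgeFinset.card ≤ T.edgeFinset.card :=
        Finset.card_le_card (SimpleGraph.edgeFinset_mono hFT)
    _ ≤ Fintype.card V := (Nat.le_succ _).trans hT.card_edgeFinset.le

open Classical in
theorem exists_spansComponents {V : Type*} [Fintype V] (G : SimpleGraph V) :
    ∃ K : Finset (V × V), K.card ≤ 2 * Fintype.card V ∧ SpansComponents K G := by
  obtain ⟨F, hFG, hF, hreach⟩ := G.exists_isAcyclic_reachable_eq_le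
  refine ⟨Finset.univ.filter fun p => F.Adj p.1 p.2, ?_, fun x y hxy => ?_⟩
  · exact F.two_mul_card_edgeFinset.symm.trans_le
      (Nat.mul_le_mul_left 2 (card_edgeFinset_le_of_isAcyclic hF))
  · rw [← hreach, SimpleGraph.reachable_iff_reflTransGen] at hxy
    exact Relation.ReflTransGen.mono (fun a b hab => ⟨hFG hab, by simpa using hab⟩) _ _ hxy

open Classical in
theorem Pattern.exists_hasRepresentatives {V W : Type*} [Fintype V] [Fintype W] (P : Pattern W)
    (k : ℕ) (Z : Zoning V) (adj : V → V → Prop) :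
    ∃ K : Finset (V × V),
      K.card ≤ Fintype.card V * (k * 4 ^ Fintype.card W * Fintype.card W ^ 2) ∧
      ∀ l, P.HasRepresentatives k Z adj (fun x y => (x, y) ∈ K) l := by
  rcases isEmpty_or_nonempty V with hV | hV
  · exact ⟨∅, by simp, fun _ _ _ _ _ c => isEmptyElim c⟩
  let φ : V × Fin k × Set W × Set W → W → V := fun q =>
    Classical.epsilon (P.IsRootedCopy Z adj q.2.1 q.2.2.1 q.2.2.2 q.1)
  refine ⟨(Finset.univ : Finset ((V × Fin k × Set W × Set W) × (W × W))).image
    fun q => (φ q.1 q.2.1, φ q.1 q.2.2), ?_, ?_⟩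
  · refine Finset.card_image_le.trans (le_of_eq ?_)
    simp only [Finset.card_univ, Fintype.card_prod, Fintype.card_fin, Fintype.card_set]
    rw [show (4 : ℕ) = 2 * 2 from rfl, mul_pow]
    ring
  · intro l j hj S R c _ f hf
    refine ⟨φ (c, ⟨j, hj⟩, S, R), Classical.epsilon_spec (p := P.IsRootedCopy Z adj j S R c)
      ⟨f, hf⟩, fun a _ b _ _ => ?_⟩
    exact Finset.mem_image.2 ⟨((c, ⟨j, hj⟩, S, R), (a, b)), Finset.mem_univ _, rfl⟩

theorem Pattern.HasRepresentatives.mono {V W : Type*} {P : Pattern W} {k : ℕ} {Z : Zoning V}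
    {adj known known' : V → V → Prop} {l : ℕ} (h : P.HasRepresentatives k Z adj known l)
    (hknown : ∀ x y, known x y → known' x y) : P.HasRepresentatives k Z adj known' l := by
  intro j hj S R c hc φ hφ
  obtain ⟨φ', hφ', hpairs⟩ := h j hj S R c hc φ hφ
  exact ⟨φ', hφ', hpairs.imp fun _ _ => hknown _ _⟩

/-! ### Completeness -/

/-- The list of the pairs of identifiers of a set of pairs of vertices. -/
noncomputable def identPairs {V : Type*} (ident : V → ℕ) (E : Finset (V × V)) : List (ℕ × ℕ) :=
  E.toList.map (Prod.map ident ident)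

open Classical in
/-- The edges of `G` between pairs of vertices whose adjacency is public when the pairs in `K` are
known. -/
noncomputable def publicEdges {V : Type*} [Fintype V] (Z : Zoning V) (G : SimpleGraph V)
    (K : Finset (V × V)) : Finset (V × V) :=
  Finset.univ.filter fun p => G.Adj p.1 p.2 ∧ Z.Known (fun x y => (x, y) ∈ K) p.1 p.2

/-- The global map that describes the network `G`, its zoning `Z` and the known pairs `K`. -/
noncomputable def networkMap {V : Type*} [Fintype V] (ident : V → ℕ) (Z : Zoning V)
    (G : SimpleGraph V) (K : Finset (V × V)) : GlobalMap where
  vertices := Finset.univ.toList.map fun x => (ident x, Z.label x, Z.level x)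
  edges := identPairs ident (publicEdges Z G K)
  known := identPairs ident K

section NetworkMap

variable {V : Type*} {ident : V → ℕ} {Z : Zoning V} {G : SimpleGraph V} {K : Finset (V × V)}

theorem mem_identPairs (hid : Function.Injective ident) {x y : V} :
    (ident x, ident y) ∈ identPairs ident K ↔ (x, y) ∈ K := by
  simp [identPairs, hid.eq_iff]

theorem exists_of_mem_identPairs {p : ℕ × ℕ} (hp : p ∈ identPairs ident K) :
    ∃ q ∈ K, Prod.map ident ident q = p := by
  simpa only [identPairs, List.mem_map, Finset.mem_toList] using hp

variable [Fintype V]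

theorem mem_publicEdges {p : V × V} :
    p ∈ publicEdges Z G K ↔ G.Adj p.1 p.2 ∧ Z.Known (fun x y => (x, y) ∈ K) p.1 p.2 := by
  simp only [publicEdges, Finset.mem_filter, Finset.mem_univ, true_and]

theorem mem_vertices_networkMap {t : ℕ × ℕ × ℕ} :
    t ∈ (networkMap ident Z G K).vertices ↔ ∃ x, (ident x, Z.label x, Z.level x) = t := by
  simp only [networkMap, List.mem_map, Finset.mem_toList, Finset.mem_univ, true_and]

theorem listed_networkMap : (networkMap ident Z G K).listed = Set.range ident := by
  ext a
  simp only [GlobalMap.listed, mem_vertices_networkMap, Set.mem_ofPred_eq, Set.mem_range,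
    Prod.mk.injEq]
  exact ⟨fun ⟨_, x, hx, _⟩ => ⟨x, hx⟩, fun ⟨x, hx⟩ => ⟨_, x, hx, rfl⟩⟩

theorem entry_networkMap (hid : Function.Injective ident) (x : V) :
    (networkMap ident Z G K).entry (ident x) = (Z.label x, Z.level x) := by
  have hentry : (ident x, (networkMap ident Z G K).entry (ident x)) ∈
      (networkMap ident Z G K).vertices :=
    Classical.epsilon_spec (p := fun t => (ident x, t) ∈ (networkMap ident Z G K).vertices)
      ⟨_, mem_vertices_networkMap.2 ⟨x, rfl⟩⟩
  obtain ⟨y, hy⟩ := mem_vertices_networkMap.1 hentry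
  rw [← (Prod.mk.inj hy).2, hid (Prod.mk.inj hy).1]

theorem comap_zoning_networkMap (hid : Function.Injective ident) :
    (networkMap ident Z G K).zoning.comap ident = Z := by
  simp only [GlobalMap.zoning, Zoning.comap, Function.comp_def, entry_networkMap hid]

theorem label_networkMap (hid : Function.Injective ident) (x : V) :
    (networkMap ident Z G K).zoning.label (ident x) = Z.label x :=
  congrFun (congrArg Zoning.label (comap_zoning_networkMap hid)) x

theorem level_networkMap (hid : Function.Injective ident) (x : V) :
    (networkMap ident Z G K).zoning.level (ident x) = Z.level x :=
  congrFun (congrArg Zoning.level (comap_zoning_networkMap hid)) x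

theorem mem_known_networkMap_iff (hid : Function.Injective ident) {x y : V} :
    (ident x, ident y) ∈ (networkMap ident Z G K).known ↔ (x, y) ∈ K :=
  mem_identPairs hid

theorem known_networkMap_iff (hid : Function.Injective ident) {x y : V} :
    (networkMap ident Z G K).Known (ident x) (ident y) ↔ Z.Known (fun x y => (x, y) ∈ K) x y := by
  simp only [GlobalMap.Known, Zoning.Known, label_networkMap hid, level_networkMap hid,
    mem_known_networkMap_iff hid]

theorem mem_edges_networkMap_iff (hid : Function.Injective ident) {x y : V} :
    (ident x, ident y) ∈ (networkMap ident Z G K).edges ↔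
      G.Adj x y ∧ Z.Known (fun x y => (x, y) ∈ K) x y :=
  (mem_identPairs hid).trans mem_publicEdges

theorem isCorrect_networkMap {k : ℕ} (hid : Function.Injective ident) (hZ : Z.IsCompatible k G) :
    (networkMap ident Z G K).IsCorrect k G ident where
  listed_eq := listed_networkMap
  isLocallyCorrect x :=
    { mem_listed := listed_networkMap (ident := ident) ▸ ⟨x, rfl⟩
      mem_edges_iff := by
        intro b
        constructor
        · intro hb
          obtain ⟨⟨x', y⟩, hxy, heq⟩ := exists_of_mem_identPairs hb
          obtain ⟨hx, rfl⟩ := Prod.mk.inj heq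
          obtain rfl := hid hx
          exact ⟨⟨y, (mem_publicEdges.1 hxy).1, rfl⟩,
            (known_networkMap_iff hid).2 (mem_publicEdges.1 hxy).2⟩
        · rintro ⟨⟨y, hxy, rfl⟩, hknown⟩
          exact (mem_edges_networkMap_iff hid).2 ⟨hxy, (known_networkMap_iff hid).1 hknown⟩
      label_eq := by
        rintro _ ⟨y, hxy, rfl⟩ hx
        rw [level_networkMap hid] at hx
        rw [label_networkMap hid, label_networkMap hid, hZ.label_eq hxy hx]
      level_le := by
        rintro _ ⟨y, hxy, rfl⟩
        rw [level_networkMap hid, level_networkMap hid]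
        exact hZ.level_le hxy }

theorem isConsistent_networkMap {k : ℕ} (hid : Function.Injective ident) (hG : G.Connected)
    (hpred : ∀ x, 0 < Z.level x → Z.level x < k → ∃ y, G.Adj x y ∧ Z.level y + 1 = Z.level x)
    (hzone : ∀ x y, Z.label x = Z.label y → (zoneGraph G Z.level k).Reachable x y)
    (hK : SpansComponents K G) (hKzone : SpansComponents K (zoneGraph G Z.level k)) :
    (networkMap ident Z G K).IsConsistent k where
  connected := by
    rw [listed_networkMap]
    rintro _ ⟨x, rfl⟩ _ ⟨y, rfl⟩
    refine (hK x y (hG.preconnected x y)).lift ident fun a b hab => ?_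
    exact (mem_edges_networkMap_iff hid).2 ⟨hab.1, .inr (.inr (.inr hab.2))⟩
  level_pred := by
    rw [listed_networkMap]
    rintro _ ⟨x, rfl⟩ hpos hlt
    rw [level_networkMap hid] at hpos hlt
    obtain ⟨y, hxy, hlevel⟩ := hpred x hpos hlt
    refine ⟨ident y, (mem_edges_networkMap_iff hid).2 ⟨hxy, .inl hpos.ne'⟩, ?_⟩
    rw [level_networkMap hid, level_networkMap hid, hlevel]
  zone_connected := by
    rw [listed_networkMap]
    rintro _ ⟨x, rfl⟩ _ ⟨y, rfl⟩ hlabel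
    rw [label_networkMap hid, label_networkMap hid] at hlabel
    refine (hKzone x y (hzone x y hlabel)).lift ident fun a b hab => ?_
    simp only [Function.onFun, level_networkMap hid]
    exact ⟨(mem_edges_networkMap_iff hid).2 ⟨hab.1.1, .inr (.inr (.inr hab.2))⟩, hab.1.2⟩

end NetworkMap

/-- The edges of a network, on the identifiers. -/
def networkEdges {V : Type*} (G : SimpleGraph V) (ident : V → ℕ) : Set (ℕ × ℕ) :=
  Prod.map ident ident '' {p | G.Adj p.1 p.2}

section Acceptance

variable {V W : Type*} {P : Pattern W} {G : SimpleGraph V} {ident : V → ℕ} {cert : V → List Bool}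
  {k : ℕ} {g : GlobalMap}

theorem mem_networkEdges_iff (hid : Function.Injective ident) {x y : V} :
    (ident x, ident y) ∈ networkEdges G ident ↔ G.Adj x y :=
  (hid.prodMap hid).mem_set_image (a := (x, y))

theorem acceptsMap_of_isCorrect (hid : Function.Injective ident) (hk : 0 < k)
    (hg : g.IsCorrect k G ident) (hcons : g.IsConsistent k)
    (hmap : ∀ y, (Certificate.decode (cert y)).map = g)
    (hgathered : ∀ u, g.zoning.level (ident u) = 0 →
      gatheredEdges G cert u = networkEdges G ident)
    (hrep : ∀ l, P.HasRepresentatives k (g.zoning.comap ident) G.Adj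
      ((g.zoning.comap ident).Known fun y z => (ident y, ident z) ∈ g.known) l)
    (hno : ¬ ∃ f, P.IsCopyOn G.Adj Set.univ f) (x : V) :
    (localView G ident cert k x).AcceptsMap k P g := by
  have hedges : ∀ {u i}, G.edist x u ≤ (i : ℕ) → i < k → g.zoning.level (ident u) = 0 →
      (localView G ident cert k x).gathered (ident u) = networkEdges G ident :=
    fun hu hi hlevel => (gathered_localView hid hu hi).trans (hgathered _ hlevel)
  have hself : g.zoning.level (ident x) = 0 →
      (localView G ident cert k x).gathered (ident x) = networkEdges G ident :=
    hedges (i := 0) (by simp) hk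
  have hneighbors := neighbors_localView (G := G) (x := x) (cert := cert) hid hk
  have hcovers : g.CoversZone G ident x ((localView G ident cert k x).gathered (ident x)) := by
    intro hx y z _ _
    rw [hself hx, mem_networkEdges_iff hid]
  refine
    { map_eq := ?_
      isConsistent := hcons
      isLocallyCorrect := hneighbors ▸ hg.isLocallyCorrect x
      gathered_eq := ?_
      mem_gathered_iff := fun hx b => ?_
      isExcludedBy := (hg.isExcludedBy_iff hid hcovers).2
        ⟨fun ⟨φ, _, hφ⟩ => hno ⟨φ, hφ⟩, fun _ => hrep _⟩ }
  · rintro _ _ ⟨y, -, hy⟩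
    rw [(Prod.mk.inj hy).2, hmap]
  · have hik : k - 1 < k := Nat.sub_lt hk one_pos
    rw [ball_localView hid hik]
    rintro _ ⟨u, hu, rfl⟩ _ ⟨v, hv, rfl⟩ hu0 hv0
    rw [hedges hu hik hu0, hedges hv hik hv0]
  · change (ident x, b) ∈ (localView G ident cert k x).gathered (ident x) ↔
      b ∈ (localView G ident cert k x).neighbors (ident x)
    rw [hself hx, hneighbors]
    constructor
    · rintro ⟨⟨x', y⟩, hxy, heq⟩
      obtain ⟨hx', rfl⟩ := Prod.mk.inj heq
      obtain rfl := hid hx'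
      exact ⟨y, hxy, rfl⟩
    · rintro ⟨y, hxy, rfl⟩
      exact (mem_networkEdges_iff hid).2 hxy

end Acceptance

section Certificates

variable {V W : Type*} [Fintype V] {P : Pattern W} {G : SimpleGraph V} {ident : V → ℕ} {k : ℕ}
  {A : Set V} {K : Finset (V × V)} {share : V → Finset (V × V)} {u : V}

/-- The certificates in which the high vertices are those in `A`, the known pairs are those in `K`,
and the edges are distributed by `share`. -/
noncomputable def networkCertificate (G : SimpleGraph V) (ident : V → ℕ) (k : ℕ) (A : Set V)
    (K : Finset (V × V)) (share : V → Finset (V × V)) (y : V) : Certificate :=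
  ⟨networkMap ident (distanceZoning G A k ident) G K, identPairs ident (share y)⟩

theorem gatheredEdges_networkCertificate (hid : Function.Injective ident)
    (hshare : ∀ y, ∀ p ∈ share y, G.Adj p.1 p.2)
    (hu : ∀ p : V × V, G.Adj p.1 p.2 → ∃ y, G.Adj u y ∧ p ∈ share y) :
    gatheredEdges G (fun y => (networkCertificate G ident k A K share y).code) u =
      networkEdges G ident := by
  simp only [gatheredEdges, Certificate.decode_code, networkCertificate]
  ext p
  constructor
  · rintro ⟨y, -, hp⟩
    obtain ⟨q, hq, rfl⟩ := exists_of_mem_identPairs hp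
    exact ⟨q, hshare y q hq, rfl⟩
  · rintro ⟨q, hq, rfl⟩
    obtain ⟨y, huy, hy⟩ := hu q hq
    exact ⟨y, huy, (mem_identPairs hid).2 hy⟩

theorem accepts_networkCertificate (hk : 0 < k) (hid : Function.Injective ident)
    (hG : G.Connected) (hK : SpansComponents K G)
    (hKzone : SpansComponents K (zoneGraph G (cutDist G A k) k))
    (hrep : ∀ l, P.HasRepresentatives k (distanceZoning G A k ident) G.Adj
      (fun x y => (x, y) ∈ K) l)
    (hshare : ∀ y, ∀ p ∈ share y, G.Adj p.1 p.2)
    (hA : ∀ u ∈ A, ∀ p : V × V, G.Adj p.1 p.2 → ∃ y, G.Adj u y ∧ p ∈ share y)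
    (hno : ¬ ∃ f, P.IsCopyOn G.Adj Set.univ f) (x : V) :
    (localView G ident (fun y => (networkCertificate G ident k A K share y).code) k x).Accepts
      k P := by
  refine ⟨_, acceptsMap_of_isCorrect hid hk (isCorrect_networkMap (K := K) hid
    isCompatible_distanceZoning) (isConsistent_networkMap hid hG
      (fun _ => exists_adj_cutDist_succ_eq) (fun _ _ => reachable_of_label_distanceZoning_eq hid)
      hK hKzone) (fun y => ?_) (fun u hu => ?_) (fun l => ?_) hno x⟩
  · rw [Certificate.decode_code, networkCertificate]
  · rw [level_networkMap hid] at hu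
    exact gatheredEdges_networkCertificate hid hshare (hA u ((cutDist_eq_zero_iff hk).1 hu))
  · rw [comap_zoning_networkMap hid]
    exact (hrep l).mono fun y z hyz => .inr (.inr (.inr ((mem_known_networkMap_iff hid).2 hyz)))

theorem length_code_networkCertificate_le {B : ℕ} (hident : ∀ x, (ident x).size ≤ B) (hk : k ≤ B)
    (x : V) :
    (networkCertificate G ident k A K share x).code.length ≤
      (Fintype.card V + (publicEdges (distanceZoning G A k ident) G K).card + K.card +
        (share x).card) * (6 * B + 4) + 4 := by
  have hpairs : ∀ E : Finset (V × V), ∀ t ∈ identPairs ident E, t.1.size ≤ B ∧ t.2.size ≤ B := by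
    intro E t ht
    obtain ⟨q, -, rfl⟩ := exists_of_mem_identPairs ht
    exact ⟨hident _, hident _⟩
  have hlength := (networkCertificate G ident k A K share x).length_code_le B (fun t ht => ?_)
    (hpairs _) (hpairs _) (hpairs _)
  · simpa [networkCertificate, networkMap, identPairs] using hlength
  · obtain ⟨y, rfl⟩ := mem_vertices_networkMap.1 ht
    exact ⟨hident y, hident _, (Nat.size_le.2 (cutDist_le.trans_lt Nat.lt_two_pow_self)).trans hk⟩

open Classical in
theorem exists_known_pairs [Fintype W] (P : Pattern W) (k : ℕ) (Z : Zoning V) (G : SimpleGraph V) :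
    ∃ K : Finset (V × V),
      K.card ≤ Fintype.card V * (4 + k * 4 ^ Fintype.card W * Fintype.card W ^ 2) ∧
      SpansComponents K G ∧ SpansComponents K (zoneGraph G Z.level k) ∧
      ∀ l, P.HasRepresentatives k Z G.Adj (fun x y => (x, y) ∈ K) l := by
  obtain ⟨K₁, hcard₁, hK₁⟩ := exists_spansComponents G
  obtain ⟨K₂, hcard₂, hK₂⟩ := exists_spansComponents (zoneGraph G Z.level k)
  obtain ⟨K₃, hcard₃, hK₃⟩ := P.exists_hasRepresentatives k Z G.Adj
  refine ⟨K₁ ∪ K₂ ∪ K₃, ?_, hK₁.mono ?_, hK₂.mono ?_, fun l => (hK₃ l).mono ?_⟩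
  · have h₁ := Finset.card_union_le (K₁ ∪ K₂) K₃
    have h₂ := Finset.card_union_le K₁ K₂
    rw [mul_add]
    omega
  · exact Finset.subset_union_left.trans Finset.subset_union_left
  · exact Finset.subset_union_right.trans Finset.subset_union_left
  · exact fun _ _ => Finset.mem_union_right _

end Certificates

/-! ### The size of the certificates -/

/-- An upper bound for the square root of `n`, which serves as the number of shares and as the size
of the colour classes. -/
def rootCeil (n : ℕ) : ℕ := n.sqrt + 1

/-- The size of the certificates, for patterns with at most `m` vertices. -/
def certificateSize (k c m n : ℕ) : ℕ :=
  ((14 + 2 * (k * 4 ^ m * m ^ 2)) * (6 * (c + k) + 4) + 4) * (n * rootCeil n * n.size ^ 2)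

section Size

variable {V W : Type*} [Fintype V]

theorem exists_shares (G : SimpleGraph V) [DecidableRel G.Adj] :
    ∃ share : V → Finset (V × V),
      (∀ x, (share x).card ≤ rootCeil (Fintype.card V) * Fintype.card V) ∧
      (∀ x, ∀ p ∈ share x, G.Adj p.1 p.2) ∧
      ∀ u, rootCeil (Fintype.card V) * (2 * (Fintype.card V).size) ≤ G.degree u →
        ∀ p : V × V, G.Adj p.1 p.2 → ∃ y, G.Adj u y ∧ p ∈ share y := by
  classical
  set n := Fintype.card V
  have hn : n < 2 ^ n.size := Nat.lt_size_self n
  have hQ : rootCeil n ≤ 2 ^ n.size := (Nat.succ_le_succ n.sqrt_le_self).trans hn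
  have hnQ : n * rootCeil n < 2 ^ (2 * n.size) := by
    rw [two_mul, pow_add]
    exact Nat.mul_lt_mul_of_lt_of_le hn hQ (Nat.two_pow_pos _)
  obtain ⟨χ, hχ⟩ := exists_coloring_seeing_all hnQ n.sqrt.succ_pos fun x => G.neighborFinset x
  obtain ⟨κ, hκ⟩ := exists_small_classes (V := V) (Nat.lt_succ_sqrt n).le
  refine ⟨fun x => Finset.univ.filter fun p => κ p.1 = χ x ∧ G.Adj p.1 p.2, fun x => ?_,
    fun x p hp => (Finset.mem_filter.1 hp).2.2, fun u hu p hp => ?_⟩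
  · calc _ ≤ ((Finset.univ.filter fun y => κ y = χ x) ×ˢ (Finset.univ : Finset V)).card :=
          Finset.card_le_card fun p hp => by simpa using (Finset.mem_filter.1 hp).2.1
      _ ≤ rootCeil n * n := by
          rw [Finset.card_product]
          exact Nat.mul_le_mul_right n (hκ (χ x) _ (by simp))
  · obtain ⟨y, huy, hy⟩ := hχ u (by rwa [SimpleGraph.card_neighborFinset_eq_degree]) (κ p.1)
    exact ⟨y, (G.mem_neighborFinset u y).1 huy,
      Finset.mem_filter.2 ⟨Finset.mem_univ p, hy.symm, hp⟩⟩

theorem card_adj_pairs_le {G : SimpleGraph V} [DecidableRel G.Adj] {q : V → Prop}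
    [DecidablePred q] {d : ℕ} (hd : ∀ x, q x → G.degree x ≤ d) :
    (Finset.univ.filter fun p : V × V => q p.1 ∧ G.Adj p.1 p.2).card ≤ Fintype.card V * d := by
  classical
  rw [mul_comm]
  refine Finset.card_le_mul_card_image_of_maps_to (f := Prod.fst) (t := Finset.univ)
    (fun _ _ => Finset.mem_univ _) d fun x _ => ?_
  by_cases hx : q x
  · refine (Finset.card_le_card_of_injOn Prod.snd (t := G.neighborFinset x) ?_ ?_).trans (hd x hx)
    · rintro ⟨y, z⟩ hp
      obtain ⟨hyz, rfl⟩ := Finset.mem_filter.1 hp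
      simpa using (Finset.mem_filter.1 hyz).2.2
    · intro p hp p' hp' hsnd
      exact Prod.ext ((Finset.mem_filter.1 hp).2.trans (Finset.mem_filter.1 hp').2.symm) hsnd
  · rw [Finset.card_eq_zero.2 (Finset.filter_eq_empty_iff.2 ?_)]
    · exact Nat.zero_le d
    · rintro p hp rfl
      exact hx (Finset.mem_filter.1 hp).2.1

open Classical in
theorem card_publicEdges_le {k : ℕ} (hk : 2 ≤ k) {Z : Zoning V} {G : SimpleGraph V}
    (hZ : Z.IsCompatible k G) (K : Finset (V × V)) {d : ℕ}
    (hd : ∀ x, Z.level x ≠ 0 → G.degree x ≤ d) :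
    (publicEdges Z G K).card ≤ 2 * (Fintype.card V * d) + K.card := by
  set E := Finset.univ.filter fun p : V × V => Z.level p.1 ≠ 0 ∧ G.Adj p.1 p.2
  have hE : E.card ≤ Fintype.card V * d := card_adj_pairs_le hd
  have hsubset : publicEdges Z G K ⊆ E ∪ E.image Prod.swap ∪ K := by
    intro p hp
    obtain ⟨hadj, hfst | hsnd | hlabel | hmem⟩ := mem_publicEdges.1 hp
    · simp [E, hfst, hadj]
    · have hswap : p.swap ∈ E := by simp [E, hsnd, hadj.symm]
      exact Finset.mem_union_left _ (Finset.mem_union_right _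
        (Finset.mem_image.2 ⟨_, hswap, p.swap_swap⟩))
    · by_cases hfst : Z.level p.1 = 0
      · exact absurd (hZ.label_eq hadj (by omega)).symm hlabel
      · simp [E, hfst, hadj]
    · simp [hmem]
  have h₁ := Finset.card_le_card hsubset
  have h₂ := Finset.card_union_le (E ∪ E.image Prod.swap) K
  have h₃ := Finset.card_union_le E (E.image Prod.swap)
  have h₄ := Finset.card_image_le (s := E) (f := Prod.swap)
  omega

theorem mul_add_four_le_of_counts {n Q σ k c κ e K l : ℕ} (hn : 0 < n) (hQ : 0 < Q) (hσ : 0 < σ)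
    (he : e ≤ 2 * (n * (Q * (2 * σ))) + K) (hK : K ≤ n * (4 + κ)) (hl : l ≤ Q * n) :
    (n + e + K + l) * (6 * (c * σ + k) + 4) + 4 ≤
      ((14 + 2 * κ) * (6 * (c + k) + 4) + 4) * (n * Q * σ ^ 2) := by
  have hunit : n ≤ n * Q * σ := by
    rw [mul_assoc]
    exact Nat.le_mul_of_pos_right n (Nat.mul_pos hQ hσ)
  have hshare : Q * n ≤ n * Q * σ := by
    rw [mul_comm Q n]
    exact Nat.le_mul_of_pos_right _ hσ
  have hknown : n * (4 + κ) ≤ (n * Q * σ) * (4 + κ) := Nat.mul_le_mul_right _ hunit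
  have hcount : n + e + K + l ≤ (14 + 2 * κ) * (n * Q * σ) := by nlinarith
  have hbits : 6 * (c * σ + k) + 4 ≤ (6 * (c + k) + 4) * σ := by nlinarith
  have hpos : 0 < n * Q * σ ^ 2 := by positivity
  calc _ ≤ ((14 + 2 * κ) * (n * Q * σ)) * ((6 * (c + k) + 4) * σ) + 4 * (n * Q * σ ^ 2) :=
        Nat.add_le_add (Nat.mul_le_mul hcount hbits) (by omega)
    _ = _ := by ring

theorem exists_accepted_certificates [Fintype W] {P : Pattern W} {G : SimpleGraph V} {k c m : ℕ}
    (hk : 2 ≤ k) (hW : Fintype.card W ≤ m) (hG : G.Connected) {ident : V → ℕ}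
    (hid : IsIdentAssignment c ident) (hno : ¬ ∃ f, P.IsCopyOn G.Adj Set.univ f) :
    ∃ cert : V → List Bool,
      (∀ x, (cert x).length ≤ certificateSize k c m (Fintype.card V)) ∧
      ∀ x, (localView G ident cert k x).Accepts k P := by
  classical
  have := hG.nonempty
  set n := Fintype.card V
  have hk0 : 0 < k := by omega
  obtain ⟨share, hcard, hshare, hgather⟩ := exists_shares G
  let A : Set V := {x | rootCeil n * (2 * n.size) ≤ G.degree x}
  let Z := distanceZoning G A k ident
  obtain ⟨K, hKcard, hK, hKzone, hrep⟩ := exists_known_pairs P k Z G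
  refine ⟨fun x => (networkCertificate G ident k A K share x).code, fun x => ?_,
    accepts_networkCertificate hk0 hid.1 hG hK hKzone hrep hshare hgather hno⟩
  have hlow : ∀ x, Z.level x ≠ 0 → G.degree x ≤ rootCeil n * (2 * n.size) := fun x hx =>
    (not_le.1 fun hle => hx ((cutDist_eq_zero_iff hk0).2 hle)).le
  have hKcard' : K.card ≤ n * (4 + k * 4 ^ m * m ^ 2) := hKcard.trans (by gcongr; norm_num)
  exact (length_code_networkCertificate_le (fun x => (hid.2 x).trans (Nat.le_add_right _ k))
    (Nat.le_add_left k _) x).trans (mul_add_four_le_of_counts Fintype.card_pos n.sqrt.succ_pos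
      (Nat.size_pos.2 Fintype.card_pos)
      (card_publicEdges_le hk isCompatible_distanceZoning K hlow) hKcard' (hcard x))

end Size

theorem natSize_le_three_mul_log {n : ℕ} (hn : 3 ≤ n) : (n.size : ℝ) ≤ 3 * Real.log n := by
  have hpos : 0 < n.size := Nat.size_pos.2 (by omega)
  have hpow : 2 ^ (n.size - 1) ≤ n := Nat.lt_size.1 (by omega)
  have hlog : (1 : ℝ) ≤ Real.log n := by
    rw [Real.le_log_iff_exp_le (by positivity)]
    exact Real.exp_one_lt_three.le.trans (by exact_mod_cast hn)
  have hsize : ((n.size - 1 : ℕ) : ℝ) * Real.log 2 ≤ Real.log n := by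
    rw [← Real.log_pow]
    exact Real.log_le_log (by positivity) (by exact_mod_cast hpow)
  rw [Nat.cast_sub hpos, Nat.cast_one] at hsize
  have hone : (1 : ℝ) ≤ n.size := by exact_mod_cast hpos
  nlinarith [Real.log_two_gt_d9]

theorem rootCeil_le_two_mul_sqrt {n : ℕ} (hn : 0 < n) : (rootCeil n : ℝ) ≤ 2 * √n := by
  have hsqrt : (n.sqrt : ℝ) ≤ √n := Real.nat_sqrt_le_real_sqrt
  have hone : 1 ≤ √(n : ℝ) := Real.one_le_sqrt.2 (by exact_mod_cast hn)
  rw [rootCeil]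
  push_cast
  linarith

theorem certificateSize_isBigO (k c m : ℕ) :
    (fun n : ℕ => (certificateSize k c m n : ℝ)) =O[Filter.atTop]
      (fun n : ℕ => (n : ℝ) ^ (3 / 2 : ℝ) * (Real.log n) ^ 2) := by
  refine Asymptotics.IsBigO.of_bound
    (((14 + 2 * (k * 4 ^ m * m ^ 2)) * (6 * (c + k) + 4) + 4 : ℕ) * 18) ?_
  filter_upwards [Filter.eventually_ge_atTop 3] with n hn
  have hn0 : (0 : ℝ) < n := by exact_mod_cast (by omega : 0 < n)
  have hpow : (n : ℝ) ^ (3 / 2 : ℝ) = n * √n := by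
    rw [Real.sqrt_eq_rpow, show (3 / 2 : ℝ) = 1 + 1 / 2 by norm_num, Real.rpow_add hn0,
      Real.rpow_one]
  rw [Real.norm_of_nonneg (by positivity), Real.norm_of_nonneg (by positivity), hpow,
    certificateSize, Nat.cast_mul, mul_assoc _ (18 : ℝ)]
  refine mul_le_mul_of_nonneg_left ?_ (Nat.cast_nonneg _)
  calc ((n * rootCeil n * n.size ^ 2 : ℕ) : ℝ) = n * rootCeil n * n.size ^ 2 := by push_cast; rfl
    _ ≤ n * (2 * √n) * (3 * Real.log n) ^ 2 := by
        gcongr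
        · exact rootCeil_le_two_mul_sqrt (by omega)
        · exact natSize_le_three_mul_log hn
    _ = 18 * (n * √n * Real.log n ^ 2) := by ring

open Classical in
theorem mainTheorem4_general (k : ℕ) (hk : 2 ≤ k) (c : ℕ) :
    ∃ s : ℕ → ℕ,
      (fun n : ℕ => (s n : ℝ)) =O[Filter.atTop]
        (fun n : ℕ => (n : ℝ) ^ (3 / 2 : ℝ) * (Real.log n) ^ 2) ∧
      ∀ (W : Type v) [Fintype W] (P : Pattern W), Fintype.card W ≤ 4 * k - 1 →
        HasLocalCertification.{u} c k s
          (fun V _ G => ¬ ∃ f : W → V, P.IsCopyOn G.Adj Set.univ f) := by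
  refine ⟨certificateSize k c (4 * k - 1), certificateSize_isBigO k c (4 * k - 1),
    fun W _ P hW => ⟨fun w => decide (w.Accepts k P), fun V _ G hG ident hid =>
      ⟨fun hno => ?_, fun hcopy cert => ?_⟩⟩⟩
  · simpa only [decide_eq_true_eq] using exists_accepted_certificates hk hW hG hid hno
  · by_contra! hacc
    obtain ⟨f, hf⟩ := not_not.1 hcopy
    have hW' : Fintype.card W < 4 * k := by omega
    exact not_isCopyOn_of_accepts (by omega) hW' hG hid.1 (fun x => by simpa using hacc x) f hf

theorem mainTheorem4 (k : ℕ) (hk : 2 ≤ k) (c : ℕ) :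
    ∃ s : ℕ → ℕ,
      (fun n : ℕ => (s n : ℝ)) =O[Filter.atTop]
        (fun n : ℕ => (n : ℝ) ^ (3 / 2 : ℝ) * (Real.log n) ^ 2) ∧
      ∀ (W : Type v) [Fintype W] (H : SimpleGraph W), Fintype.card W ≤ 4 * k - 1 →
        HasLocalCertification.{u} c k s (fun _ _ G => ¬ H.IsIndContained G) ∧
        HasLocalCertification.{u} c k s (fun _ _ G => ¬ H.IsContained G) := by
  obtain ⟨s, hs, hcert⟩ := mainTheorem4_general k hk c
  simp only [isIndContained_iff_exists_isCopyOn, isContained_iff_exists_isCopyOn]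
  exact ⟨s, hs, fun W _ H hW => ⟨hcert W (inducedPattern H) hW, hcert W (subgraphPattern H) hW⟩⟩
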